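/- Let $\mathcal X$ be a non-empty finite set, $\mathcal P(\mathcal X)\subset\mathbb R^{\mathcal X}$ the simplex of probability measures on $\mathcal X$, and $\mathcal P^*(\mathcal X)$ the set of those with full support. For each $x\in\mathcal X$ let $K_x$ be a real function that is twice continuously differentiable on (an open neighbourhood of) $\mathcal P(\mathcal X)$. Put $$U(\mu)=\sum_x\mu_xK_x(\mu),\quad H_x(\mu)=\frac{\partial U}{\partial\mu_x}(\mu),\quad \pi_x(\mu)=\frac{e^{-H_x(\mu)}}{\sum_ye^{-H_y(\mu)}},\quad \mathcal F(\mu)=\sum_x\mu_x\log\mu_x+U(\mu),$$ with $0\log 0=0$. For each $\mu\in\mathcal P(\mathcal X)$ let $Q(\mu)=(Q_{xy}(\mu))_{x,y\in\mathcal X}$ be the rate matrix of an irreducible continuous-time Markov chain on $\mathcal X$ (that is, $Q_{xy}(\mu)\ge 0$ for $x\ne y$ and $Q_{xx}(\mu)=-\sum_{y\neq x}Q_{xy}(\mu)$) that is reversible with respect to $\pi(\mu)$, i.e. $\pi_x(\mu)Q_{xy}(\mu)=\pi_y(\mu)Q_{yx}(\mu)$ for all $x,y$; and let each $\mu\mapsto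 Q_{xy}(\mu)$ be Lipschitz on $\mathcal P(\mathcal X)$. Consider the evolution equation $$\dot\mu_t=\mu_tQ(\mu_t)\qquad(\ast)$$ in $\mathcal P(\mathcal X)$; a stationary point is a $\nu\in\mathcal P(\mathcal X)$ with $\nu Q(\nu)=0$. Let $\Lambda(a,b)=\int_0^1a^{1-s}b^s\,ds$ be the logarithmic mean, and for $x\ne y$ let $\Lambda_{xy}(\mu)=\Lambda(\mu_xQ_{xy}(\mu),\mu_yQ_{yx}(\mu))$. For $\mu_0,\mu_1\in\mathcal P(\mathcal X)$ let $$\mathcal W(\mu_0,\mu_1)=\inf\Bigl(\int_0^1\tfrac12\sum_{x\neq y}(\psi_t(y)-\psi_t(x))^2\Lambda_{xy}(\mu_t)\,dt\Bigr)^{1/2},$$ the infimum being over all continuous curves $(\mu_t)_{t\in[0,1]}$ in $\mathcal P(\mathcal X)$ from $\mu_0$ to $\mu_1$ and all integrable $\psi:[0,1]\to\mathbb R^{\mathcal X}$ such that, in the sense of distributions, $\dot\mu_t(x)=-\sum_{y\neq x}\Lambda_{xy}(\mu_t)(\psi_t(y)-\psi_t(x))$ for all $x\in\mathcal X$. A $\mathcal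 W$-geodesic is a curve $(\mu_t)_{t\in[0,1]}$ in $\mathcal P(\mathcal X)$ with $\mathcal W(\mu_s,\mu_t)=|t-s|\,\mathcal W(\mu_0,\mu_1)$ for all $s,t\in[0,1]$. One says that $\mathrm{Ric}(\mathcal X,Q,\pi)\ge\kappa$ if for every $\mathcal W$-geodesic and every $t\in[0,1]$ $$\mathcal F(\mu_t)\le(1-t)\mathcal F(\mu_0)+t\mathcal F(\mu_1)-\tfrac{\kappa}{2}t(1-t)\mathcal W(\mu_0,\mu_1)^2 .$$ Finally, for $\mu\in\mathcal P^*(\mathcal X)$ let $$\mathcal I(\mu)=\tfrac12\sum_{x,y}\Theta\bigl(\mu_xQ_{xy}(\mu),\mu_yQ_{yx}(\mu)\bigr),\qquad\Theta(a,b)=(a-b)(\log a-\log b),\quad\Theta(a,a)=0,$$ and let $\mathcal I(\mu)=+\infty$ for all other $\mu\in\mathcal P(\mathcal X)$. **Theorem.** Assume that $\mathrm{Ric}(\mathcal X,Q,\pi)\ge\lambda$ for some $\lambda>0$. Then: (i) there is exactly one stationary point $\pi^*$ of $(\ast)$, and it is the unique minimizer of $\mathcal F$ on $\mathcal P(\mathcal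 X)$. Write $\mathcal F_*(\mu)=\mathcal F(\mu)-\mathcal F(\pi^*)$; (ii) $\mathcal F_*(\mu)\le\frac1{2\lambda}\,\mathcal I(\mu)$ for all $\mu\in\mathcal P(\mathcal X)$; (iii) $\mathcal F_*(\mu_t)\le e^{-2\lambda t}\mathcal F_*(\mu_0)$ for every solution $(\mu_t)_{t\ge0}$ of $(\ast)$ in $\mathcal P(\mathcal X)$ and all $t\ge0$; (iv) $\mathcal W(\mu,\pi^*)\le\sqrt{\tfrac2\lambda\,\mathcal F_*(\mu)}$ for all $\mu\in\mathcal P(\mathcal X)$. -/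

import Mathlib

namespace MeanField

open scoped ENNReal Matrix

noncomputable section

variable {X : Type*} [Fintype X] [DecidableEq X]

/-- The energy `U(μ) = ∑ₓ μₓ Kₓ(μ)`. Probability measures on the finite set `X` are the elements of
`stdSimplex ℝ X`; each `K x` is a function on `ℝ^X`, used near the simplex only. -/
def energy (K : X → (X → ℝ) → ℝ) (μ : X → ℝ) : ℝ :=
  ∑ x, μ x * K x μ

/-- The free energy `F(μ) = ∑ₓ μₓ log μₓ + U(μ)`, with `0 log 0 = 0`. -/
def freeEnergy (K : X → (X → ℝ) → ℝ) (μ : X → ℝ) : ℝ :=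
  ∑ x, μ x * Real.log (μ x) + energy K μ

/-- `Hₓ(μ) = ∂U/∂μₓ (μ)`. -/
def localHamiltonian (K : X → (X → ℝ) → ℝ) (μ : X → ℝ) (x : X) : ℝ :=
  fderiv ℝ (energy K) μ (Pi.single x 1)

/-- The local Gibbs measure `πₓ(μ) = exp(-Hₓ(μ)) / Z(μ)`. It depends on the values of `K` on the
simplex only: changing the extension of `U` off the simplex changes all `Hₓ(μ)`, for `μ` in the
simplex, by the same constant. -/
def localGibbs (K : X → (X → ℝ) → ℝ) (μ : X → ℝ) (x : X) : ℝ :=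
  Real.exp (-localHamiltonian K μ x) / ∑ y, Real.exp (-localHamiltonian K μ y)

/-- `(X, Q, π)` is a non-linear Markov triple with potential `K`: for each `μ` in the simplex,
`Q(μ)` is the rate matrix of an irreducible Markov chain, reversible with respect to `π(μ)`.
Being twice continuously differentiable on the (closed) simplex means being so on an open
neighbourhood of it. -/
structure IsNonlinearMarkovTriple (K : X → (X → ℝ) → ℝ) (Q : (X → ℝ) → Matrix X X ℝ) : Prop where
  contDiff_potential : ∀ x, ∃ V : Set (X → ℝ), IsOpen V ∧ stdSimplex ℝ X ⊆ V ∧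
    ContDiffOn ℝ 2 (K x) V
  rate_nonneg : ∀ μ ∈ stdSimplex ℝ X, ∀ x y, x ≠ y → 0 ≤ Q μ x y
  rate_diag : ∀ μ ∈ stdSimplex ℝ X, ∀ x, Q μ x x = -∑ y ∈ Finset.univ.erase x, Q μ x y
  irreducible : ∀ μ ∈ stdSimplex ℝ X, ∀ x y, Relation.ReflTransGen (fun a b => 0 < Q μ a b) x y
  detailed_balance : ∀ μ ∈ stdSimplex ℝ X, ∀ x y,
    localGibbs K μ x * Q μ x y = localGibbs K μ y * Q μ y x
  lipschitz : ∀ x y, ∃ C, LipschitzOnWith C (fun μ => Q μ x y) (stdSimplex ℝ X)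

/-- A stationary point of the evolution `μ' = μ Q(μ)`. -/
def IsStationary (Q : (X → ℝ) → Matrix X X ℝ) (μ : X → ℝ) : Prop :=
  μ ∈ stdSimplex ℝ X ∧ μ ᵥ* Q μ = 0

/-- A solution `(μ_t)_{t ≥ 0}` of `μ' = μ Q(μ)` (at `t = 0` with the one-sided derivative). -/
def IsSolution (Q : (X → ℝ) → Matrix X X ℝ) (μ : ℝ → X → ℝ) : Prop :=
  ∀ t, 0 ≤ t → μ t ∈ stdSimplex ℝ X ∧
    HasDerivWithinAt μ (μ t ᵥ* Q (μ t)) (Set.Ici 0) t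

/-- The logarithmic mean `Λ(a, b) = ∫₀¹ a^(1-s) b^s ds` of `a, b ≥ 0`. -/
def logMean (a b : ℝ) : ℝ :=
  ∫ s in (0 : ℝ)..1, a ^ (1 - s) * b ^ s

/-- `Λ(μ)_{xy} = Λ(μₓ Q_{xy}(μ), μ_y Q_{yx}(μ))`. It is only used multiplied with
`ψ_y - ψ_x`, so that its values on the diagonal, where `Q` is not positive, do not matter. -/
def edgeWeight (Q : (X → ℝ) → Matrix X X ℝ) (μ : X → ℝ) (x y : X) : ℝ :=
  logMean (μ x * Q μ x y) (μ y * Q μ y x)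

/-- The Onsager operator `K[μ]ψ = -∇·(Λ(μ)∇ψ)`, i.e. `(K[μ]ψ)ₓ = -∑_y Λ(μ)_{xy} (ψ_y - ψₓ)`. -/
def onsager (Q : (X → ℝ) → Matrix X X ℝ) (μ ψ : X → ℝ) (x : X) : ℝ :=
  -∑ y, edgeWeight Q μ x y * (ψ y - ψ x)

/-- The action `A(μ, ψ) = ⟨ψ, K[μ]ψ⟩ = ½ ∑_{x,y} (ψ_y - ψₓ)² Λ(μ)_{xy}`. -/
def action (Q : (X → ℝ) → Matrix X X ℝ) (μ ψ : X → ℝ) : ℝ :=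
  (1 / 2) * ∑ x, ∑ y, (ψ y - ψ x) ^ 2 * edgeWeight Q μ x y

/-- The set CE of pairs of a continuous curve `(μ_t)` of probability measures and an
integrable `(ψ_t)`, `t ∈ [0,1]`, with `μ' = K[μ]ψ` in the distribution sense. As `μ` is continuous
and `t ↦ K[μ_t]ψ_t` is integrable (the weights being bounded along `μ`), the latter means that
`μ_t - μ_0` is the integral of `K[μ_s]ψ_s` over `[0,t]`. -/
structure ContinuityEquation (Q : (X → ℝ) → Matrix X X ℝ) (μ ψ : ℝ → X → ℝ) : Prop where
  mem_simplex : ∀ t ∈ Set.Icc (0 : ℝ) 1, μ t ∈ stdSimplex ℝ X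
  continuousOn : ContinuousOn μ (Set.Icc 0 1)
  integrableOn : MeasureTheory.IntegrableOn ψ (Set.Icc 0 1)
  equation : ∀ t ∈ Set.Icc (0 : ℝ) 1, ∀ x,
    μ t x - μ 0 x = ∫ s in (0 : ℝ)..t, onsager Q (μ s) (ψ s) x

/-- The transport distance `W(μ₀, μ₁) = inf (∫₀¹ A(μ_t, ψ_t) dt)^(1/2)`, the infimum being over the
pairs in CE that join `μ₀` to `μ₁`. -/
def transportDist (Q : (X → ℝ) → Matrix X X ℝ) (μ₀ μ₁ : X → ℝ) : ℝ≥0∞ :=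
  ⨅ (p : (ℝ → X → ℝ) × (ℝ → X → ℝ))
    (_ : ContinuityEquation Q p.1 p.2 ∧ p.1 0 = μ₀ ∧ p.1 1 = μ₁),
    (∫⁻ t in Set.Icc (0 : ℝ) 1, ENNReal.ofReal (action Q (p.1 t) (p.2 t))) ^ (1 / 2 : ℝ)

/-- A (constant speed, minimal) `W`-geodesic `(μ_t)_{t ∈ [0,1]}` in the simplex. -/
def IsGeodesic (Q : (X → ℝ) → Matrix X X ℝ) (μ : ℝ → X → ℝ) : Prop :=
  (∀ t ∈ Set.Icc (0 : ℝ) 1, μ t ∈ stdSimplex ℝ X) ∧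
  ∀ s ∈ Set.Icc (0 : ℝ) 1, ∀ t ∈ Set.Icc (0 : ℝ) 1,
    transportDist Q (μ s) (μ t) = ENNReal.ofReal |t - s| * transportDist Q (μ 0) (μ 1)

/-- `Ric(X, Q, π) ≥ κ`: the free energy is `κ`-convex along every `W`-geodesic. -/
def RicciBoundedBelow (K : X → (X → ℝ) → ℝ) (Q : (X → ℝ) → Matrix X X ℝ) (κ : ℝ) : Prop :=
  ∀ μ : ℝ → X → ℝ, IsGeodesic Q μ → ∀ t ∈ Set.Icc (0 : ℝ) 1,
    freeEnergy K (μ t) ≤ (1 - t) * freeEnergy K (μ 0) + t * freeEnergy K (μ 1)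
      - κ / 2 * t * (1 - t) * (transportDist Q (μ 0) (μ 1)).toReal ^ 2

/-- `Θ(a, b) = (a - b)(log a - log b)`, used for `a = b = 0` and for `a, b > 0`. -/
def theta (a b : ℝ) : ℝ :=
  (a - b) * (Real.log a - Real.log b)

open Classical in
/-- The discrete Fisher information with values in `[0, ∞]`, infinite at the measures without
full support. -/
def fisher (Q : (X → ℝ) → Matrix X X ℝ) (μ : X → ℝ) : ℝ≥0∞ :=
  if ∀ x, 0 < μ x then
    ENNReal.ofReal ((1 / 2) * ∑ x, ∑ y, theta (μ x * Q μ x y) (μ y * Q μ y x))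
  else ⊤

end

end MeanField

namespace MeanField

section

open Real Set Filter Topology MeasureTheory
open scoped ENNReal Matrix

/-! ### The logarithmic mean -/

section

/-! The evolution is the gradient flow of the free energy for `W`. By detailed balance and the
identity `Λ(a,b)(log b - log a) = b - a`, the Onsager operator sends the chemical potential `log μ +
H(μ)`, the differential of `F` up to constants, to `-μQ(μ)`; its action is the Fisher information
`I(μ)`. Hence `F` decreases at rate `I` along solutions, and the theorem becomes the standard theory
of a `λ`-convex functional on a geodesic space.

Convexity along a geodesic from `μ` to `ν`, compared with the first-order expansion of `F` at `μ` as
the time tends to 0, gives the HWI inequality `F(μ) - F(ν) ≤ √I(μ) W - (λ/2) W²`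
(`freeEnergy_sub_le_hwi`). Maximizing in `W` gives (ii), and Gronwall then gives (iii). The same
convexity started at a minimizer gives (iv), hence uniqueness of the minimizer
(`eq_of_freeEnergy_le`). Minimizers have full support, because the entropy has slope `-∞` at the
boundary, so their chemical potential is constant and they are stationary. Conversely a stationary
point has full support by irreducibility and zero Fisher information, so (ii) makes it a minimizer.

The curvature hypothesis speaks of geodesics only, so most of the work is to produce one between any
two measures (`exists_isGeodesic`), although the weights degenerate at the boundary of the simplex.
The key is that `W` is finite and uniformly continuous for the Euclidean distance. In the interior a
Poincaré inequality bounds the cost of quadratically accelerated segments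
(`exists_transportDist_le_of_segment`). Boundary points are left along curves feeding mass down a
tree of positive rates with well-chosen powers of time (`exists_pos_transportDist_le`). Then nearly
optimal curves converge pointwise along an ultrafilter to a geodesic. -/

theorem logMean_integrand_le (a b : ℝ) {s : ℝ} (hs : s ∈ Set.Icc (0 : ℝ) 1) :
    ‖a ^ (1 - s) * b ^ s‖ ≤ max 1 |a| * max 1 |b| := by
  have key : ∀ c r : ℝ, 0 ≤ r → r ≤ 1 → |c ^ r| ≤ max 1 |c| := by
    intro c r h0 h1
    refine (Real.abs_rpow_le_abs_rpow c r).trans ?_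
    calc |c| ^ r ≤ (max 1 |c|) ^ r := Real.rpow_le_rpow (abs_nonneg _) (le_max_right _ _) h0
      _ ≤ (max 1 |c|) ^ (1 : ℝ) := Real.rpow_le_rpow_of_exponent_le (le_max_left _ _) h1
      _ = _ := Real.rpow_one _
  rw [Real.norm_eq_abs, abs_mul]
  exact mul_le_mul (key a _ (by linarith [hs.2]) (by linarith [hs.1])) (key b _ hs.1 hs.2)
    (abs_nonneg _) (by positivity)

theorem measurable_logMean_integrand (a b : ℝ) : Measurable fun s : ℝ => a ^ (1 - s) * b ^ s := by
  fun_prop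

theorem intervalIntegrable_logMean (a b : ℝ) :
    IntervalIntegrable (fun s : ℝ => a ^ (1 - s) * b ^ s) volume 0 1 := by
  rw [intervalIntegrable_iff_integrableOn_Icc_of_le zero_le_one]
  refine Measure.integrableOn_of_bounded (M := max 1 |a| * max 1 |b|) (by simp)
    (measurable_logMean_integrand a b).aestronglyMeasurable ?_
  filter_upwards [ae_restrict_mem measurableSet_Icc] with s hs using logMean_integrand_le a b hs

/-- Dominated convergence. The integral form is used because the quotient `(b - a)/(log b - log a)`
is singular on the diagonal and the axes, whereas the edge weights must be continuous up to the
boundary of the simplex. -/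
theorem continuous_logMean : Continuous fun p : ℝ × ℝ => logMean p.1 p.2 := by
  rw [continuous_iff_continuousAt]
  intro p
  refine intervalIntegral.continuousAt_of_dominated_interval
    (bound := fun _ => (max 1 |p.1| + 1) * (max 1 |p.2| + 1)) ?_ ?_ ?_ ?_
  · exact Eventually.of_forall fun q => (measurable_logMean_integrand q.1 q.2).aestronglyMeasurable
  · have h1 : ∀ᶠ q : ℝ × ℝ in 𝓝 p, max 1 |q.1| < max 1 |p.1| + 1 :=
      (by fun_prop : Continuous fun q : ℝ × ℝ => max 1 |q.1|).continuousAt.eventually_lt_const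
        (by simp)
    have h2 : ∀ᶠ q : ℝ × ℝ in 𝓝 p, max 1 |q.2| < max 1 |p.2| + 1 :=
      (by fun_prop : Continuous fun q : ℝ × ℝ => max 1 |q.2|).continuousAt.eventually_lt_const
        (by simp)
    filter_upwards [h1, h2] with q hq1 hq2
    refine Eventually.of_forall fun s hs => ?_
    rw [Set.uIoc_of_le zero_le_one] at hs
    exact (logMean_integrand_le q.1 q.2 ⟨hs.1.le, hs.2⟩).trans
      (mul_le_mul hq1.le hq2.le (by positivity) (by positivity))
  · exact intervalIntegrable_const
  · have : ∀ᵐ s : ℝ, s ≠ 1 := by simp [ae_iff]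
    filter_upwards [this] with s hs1 hs
    rw [Set.uIoc_of_le zero_le_one] at hs
    have hs' : s < 1 := lt_of_le_of_ne hs.2 hs1
    exact (continuousAt_fst.rpow_const (Or.inr (by linarith))).mul
      (continuousAt_snd.rpow_const (Or.inr hs.1.le))

theorem logMean_comm (a b : ℝ) : logMean a b = logMean b a := by
  unfold logMean
  have := intervalIntegral.integral_comp_sub_left (a := 0) (b := 1)
    (fun s : ℝ => a ^ (1 - s) * b ^ s) 1
  simp only [sub_zero, sub_self, sub_sub_cancel] at this
  rw [← this]
  simp_rw [mul_comm]

theorem logMean_nonneg {a b : ℝ} (ha : 0 ≤ a) (hb : 0 ≤ b) : 0 ≤ logMean a b :=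
  intervalIntegral.integral_nonneg zero_le_one fun _ _ =>
    mul_nonneg (Real.rpow_nonneg ha _) (Real.rpow_nonneg hb _)

/-- Under `s ↦ 1 - s` the integrand `u` becomes `v` with `u v = a b`; averaging the two and applying
the arithmetic-geometric inequality gives the bound. -/
theorem sqrt_mul_le_logMean {a b : ℝ} (ha : 0 ≤ a) (hb : 0 ≤ b) : √(a * b) ≤ logMean a b := by
  have h2 : 2 * logMean a b = ∫ s in (0 : ℝ)..1, (a ^ (1 - s) * b ^ s + b ^ (1 - s) * a ^ s) := by
    rw [intervalIntegral.integral_add (intervalIntegrable_logMean a b)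
      (intervalIntegrable_logMean b a), two_mul]
    nth_rewrite 2 [logMean_comm]
    rfl
  have h3 : ∫ _s in (0 : ℝ)..1, 2 * √(a * b) ≤
      ∫ s in (0 : ℝ)..1, (a ^ (1 - s) * b ^ s + b ^ (1 - s) * a ^ s) := by
    refine intervalIntegral.integral_mono_on_of_le_Ioo zero_le_one intervalIntegrable_const
      ((intervalIntegrable_logMean a b).add (intervalIntegrable_logMean b a)) fun s hs => ?_
    set u := a ^ (1 - s) * b ^ s with hu
    set v := b ^ (1 - s) * a ^ s with hv
    have hu0 : 0 ≤ u := mul_nonneg (Real.rpow_nonneg ha _) (Real.rpow_nonneg hb _)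
    have hv0 : 0 ≤ v := mul_nonneg (Real.rpow_nonneg hb _) (Real.rpow_nonneg ha _)
    have huv : u * v = a * b := by
      have e1 : a ^ (1 - s) * a ^ s = a := by
        rw [← Real.rpow_add_of_nonneg ha (by linarith [hs.2]) hs.1.le]; simp
      have e2 : b ^ (1 - s) * b ^ s = b := by
        rw [← Real.rpow_add_of_nonneg hb (by linarith [hs.2]) hs.1.le]; simp
      calc u * v = (a ^ (1 - s) * a ^ s) * (b ^ (1 - s) * b ^ s) := by rw [hu, hv]; ring
        _ = a * b := by rw [e1, e2]
    rw [← huv]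
    refine abs_le_of_sq_le_sq' ?_ (by positivity) |>.2
    rw [mul_pow, Real.sq_sqrt (by positivity)]
    nlinarith [sq_nonneg (u - v)]
  simp only [intervalIntegral.integral_const, sub_zero, one_smul] at h3
  linarith

theorem logMean_zero_zero : logMean 0 0 = 0 := by
  refine (intervalIntegral.integral_congr_ae (g := fun _ => (0 : ℝ)) ?_).trans (by simp)
  filter_upwards with s hs
  rw [Set.uIoc_of_le zero_le_one] at hs
  rw [Real.zero_rpow hs.1.ne', mul_zero]

/-- The factor `log b - log a` turns the integrand into the derivative of `a^(1-s) b^s`, which runs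
from `a` to `b`. -/
theorem logMean_mul_log {a b : ℝ} (ha : 0 < a) (hb : 0 < b) :
    logMean a b * (Real.log b - Real.log a) = b - a := by
  have hd : ∀ s ∈ Set.uIcc (0 : ℝ) 1, HasDerivAt (fun s : ℝ => a ^ (1 - s) * b ^ s)
      (a ^ (1 - s) * b ^ s * (Real.log b - Real.log a)) s := by
    intro s _
    have h1 : HasDerivAt (fun s : ℝ => a ^ (1 - s)) (Real.log a * (-1) * a ^ (1 - s)) s :=
      ((hasDerivAt_id s).const_sub 1).const_rpow ha
    have h2 : HasDerivAt (fun s : ℝ => b ^ s) (Real.log b * 1 * b ^ s) s :=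
      (hasDerivAt_id s).const_rpow hb
    refine (h1.mul h2).congr_deriv ?_
    ring
  have := intervalIntegral.integral_eq_sub_of_hasDerivAt hd
    ((intervalIntegrable_logMean a b).mul_const _)
  rw [intervalIntegral.integral_mul_const] at this
  simpa [logMean] using this

end

/-! ### The Onsager operator, the action and the gradient structure -/

section

section Weights

theorem edgeWeight_comm {X : Type*} (Q : (X → ℝ) → Matrix X X ℝ) (μ : X → ℝ) (x y : X) :
    edgeWeight Q μ x y = edgeWeight Q μ y x :=
  logMean_comm _ _

variable {X : Type*} [Fintype X]

/-- Summation by parts, from the symmetry of the weights. -/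
theorem sum_mul_onsager (Q : (X → ℝ) → Matrix X X ℝ) (μ f ψ : X → ℝ) :
    ∑ x, f x * onsager Q μ ψ x =
      1 / 2 * ∑ x, ∑ y, (f y - f x) * (ψ y - ψ x) * edgeWeight Q μ x y := by
  have h1 : ∑ x, f x * onsager Q μ ψ x =
      -∑ x, ∑ y, f x * (edgeWeight Q μ x y * (ψ y - ψ x)) := by
    simp only [onsager, mul_neg, Finset.mul_sum, Finset.sum_neg_distrib]
  have h2 : ∑ x, ∑ y, f x * (edgeWeight Q μ x y * (ψ y - ψ x)) =
      -∑ x, ∑ y, f y * (edgeWeight Q μ x y * (ψ y - ψ x)) := by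
    rw [Finset.sum_comm, ← Finset.sum_neg_distrib]
    refine Finset.sum_congr rfl fun x _ => ?_
    rw [← Finset.sum_neg_distrib]
    refine Finset.sum_congr rfl fun y _ => ?_
    rw [edgeWeight_comm Q μ y x]
    ring
  have h3 : ∑ x, ∑ y, (f y - f x) * (ψ y - ψ x) * edgeWeight Q μ x y =
      ∑ x, ∑ y, f y * (edgeWeight Q μ x y * (ψ y - ψ x)) -
        ∑ x, ∑ y, f x * (edgeWeight Q μ x y * (ψ y - ψ x)) := by
    simp only [← Finset.sum_sub_distrib]
    exact Finset.sum_congr rfl fun x _ => Finset.sum_congr rfl fun y _ => by ring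
  rw [h1, h3]
  linarith

theorem sum_onsager (Q : (X → ℝ) → Matrix X X ℝ) (μ ψ : X → ℝ) :
    ∑ x, onsager Q μ ψ x = 0 := by
  simpa using sum_mul_onsager Q μ (fun _ => 1) ψ

theorem action_eq_sum_mul_onsager (Q : (X → ℝ) → Matrix X X ℝ) (μ ψ : X → ℝ) :
    action Q μ ψ = ∑ x, ψ x * onsager Q μ ψ x := by
  rw [sum_mul_onsager, action]
  simp only [pow_two]

theorem action_smul (Q : (X → ℝ) → Matrix X X ℝ) (μ ψ : X → ℝ) (c : ℝ) :
    action Q μ (c • ψ) = c ^ 2 * action Q μ ψ := by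
  simp only [action, Pi.smul_apply, smul_eq_mul, Finset.mul_sum]
  exact Finset.sum_congr rfl fun x _ => Finset.sum_congr rfl fun y _ => by ring

theorem onsager_smul (Q : (X → ℝ) → Matrix X X ℝ) (μ ψ : X → ℝ) (c : ℝ) (x : X) :
    onsager Q μ (c • ψ) x = c * onsager Q μ ψ x := by
  simp only [onsager, Pi.smul_apply, smul_eq_mul, mul_neg, Finset.mul_sum]
  exact congrArg _ (Finset.sum_congr rfl fun y _ => by ring)

end Weights

namespace IsNonlinearMarkovTriple

variable {X : Type*} [Fintype X] [DecidableEq X] {K : X → (X → ℝ) → ℝ}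
  {Q : (X → ℝ) → Matrix X X ℝ} {μ : X → ℝ}

theorem localGibbs_pos [Nonempty X] (K : X → (X → ℝ) → ℝ) (μ : X → ℝ) (x : X) :
    0 < localGibbs K μ x := by
  unfold localGibbs
  exact div_pos (Real.exp_pos _) (Finset.sum_pos (fun _ _ => Real.exp_pos _) Finset.univ_nonempty)

theorem rate_pos_symm (hQ : IsNonlinearMarkovTriple K Q) (hμ : μ ∈ stdSimplex ℝ X) {x y : X}
    (h : 0 < Q μ x y) : 0 < Q μ y x := by
  have : Nonempty X := ⟨x⟩
  have h1 := hQ.detailed_balance μ hμ x y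
  have h2 := mul_pos (localGibbs_pos K μ x) h
  rw [h1] at h2
  exact (pos_iff_pos_of_mul_pos h2).1 (localGibbs_pos K μ y)

theorem continuousOn_rate (hQ : IsNonlinearMarkovTriple K Q) (x y : X) :
    ContinuousOn (fun μ => Q μ x y) (stdSimplex ℝ X) :=
  (hQ.lipschitz x y).choose_spec.continuousOn

theorem sum_rate (hQ : IsNonlinearMarkovTriple K Q) (hμ : μ ∈ stdSimplex ℝ X) (x : X) :
    ∑ y, Q μ x y = 0 := by
  rw [← Finset.add_sum_erase _ _ (Finset.mem_univ x), hQ.rate_diag μ hμ x]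
  simp

theorem continuousOn_edgeWeight (hQ : IsNonlinearMarkovTriple K Q) (x y : X) :
    ContinuousOn (fun μ => edgeWeight Q μ x y) (stdSimplex ℝ X) :=
  continuous_logMean.comp_continuousOn
    (((continuous_apply x).continuousOn.mul (hQ.continuousOn_rate x y)).prodMk
      ((continuous_apply y).continuousOn.mul (hQ.continuousOn_rate y x)))

theorem edgeWeight_nonneg (hQ : IsNonlinearMarkovTriple K Q) (hμ : μ ∈ stdSimplex ℝ X) {x y : X}
    (h : x ≠ y) : 0 ≤ edgeWeight Q μ x y :=
  logMean_nonneg (mul_nonneg (hμ.1 x) (hQ.rate_nonneg μ hμ x y h))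
    (mul_nonneg (hμ.1 y) (hQ.rate_nonneg μ hμ y x h.symm))

/-- Separates the masses, which may vanish, from the rates, which stay irreducible up to the
boundary. -/
theorem sqrt_mul_sqrt_le_edgeWeight (hQ : IsNonlinearMarkovTriple K Q)
    (hμ : μ ∈ stdSimplex ℝ X) {x y : X} (h : x ≠ y) :
    √(μ x * μ y) * √(Q μ x y * Q μ y x) ≤ edgeWeight Q μ x y := by
  refine le_trans (le_of_eq ?_) (sqrt_mul_le_logMean
    (mul_nonneg (hμ.1 x) (hQ.rate_nonneg μ hμ x y h))
    (mul_nonneg (hμ.1 y) (hQ.rate_nonneg μ hμ y x h.symm)))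
  rw [← Real.sqrt_mul (mul_nonneg (hμ.1 x) (hμ.1 y))]
  congr 1
  ring

theorem sq_mul_edgeWeight_nonneg (hQ : IsNonlinearMarkovTriple K Q) (hμ : μ ∈ stdSimplex ℝ X)
    (ψ : X → ℝ) (x y : X) : 0 ≤ (ψ y - ψ x) ^ 2 * edgeWeight Q μ x y := by
  rcases eq_or_ne x y with rfl | h
  · simp
  · exact mul_nonneg (sq_nonneg _) (hQ.edgeWeight_nonneg hμ h)

theorem action_nonneg (hQ : IsNonlinearMarkovTriple K Q) (hμ : μ ∈ stdSimplex ℝ X)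
    (ψ : X → ℝ) : 0 ≤ action Q μ ψ :=
  mul_nonneg (by norm_num) (Finset.sum_nonneg fun x _ => Finset.sum_nonneg fun y _ =>
    hQ.sq_mul_edgeWeight_nonneg hμ ψ x y)

/-- Each pair occurs in both orders in the double sum, which absorbs the factor `1/2`. -/
theorem sq_mul_edgeWeight_le_action (hQ : IsNonlinearMarkovTriple K Q)
    (hμ : μ ∈ stdSimplex ℝ X) (ψ : X → ℝ) {x y : X} (h : x ≠ y) :
    (ψ y - ψ x) ^ 2 * edgeWeight Q μ x y ≤ action Q μ ψ := by
  have h0 := hQ.sq_mul_edgeWeight_nonneg hμ ψ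
  have h1 : ∀ a b : X, (ψ b - ψ a) ^ 2 * edgeWeight Q μ a b ≤
      ∑ y, (ψ y - ψ a) ^ 2 * edgeWeight Q μ a y := fun a b =>
    Finset.single_le_sum (f := fun y => (ψ y - ψ a) ^ 2 * edgeWeight Q μ a y)
      (fun y _ => h0 a y) (Finset.mem_univ b)
  have h2 := Finset.add_le_sum (s := Finset.univ)
    (f := fun a => ∑ y, (ψ y - ψ a) ^ 2 * edgeWeight Q μ a y)
    (fun a _ => Finset.sum_nonneg fun y _ => h0 a y) (Finset.mem_univ x) (Finset.mem_univ y) h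
  have h3 := h1 x y
  have h4 := h1 y x
  rw [edgeWeight_comm Q μ y x] at h4
  have h5 : (ψ x - ψ y) ^ 2 = (ψ y - ψ x) ^ 2 := by ring
  rw [h5] at h4
  unfold action
  linarith

theorem continuousOn_action (hQ : IsNonlinearMarkovTriple K Q) (ψ : X → ℝ) :
    ContinuousOn (fun μ => action Q μ ψ) (stdSimplex ℝ X) :=
  continuousOn_const.mul (continuousOn_finsetSum _ fun x _ => continuousOn_finsetSum _ fun y _ =>
    continuousOn_const.mul (hQ.continuousOn_edgeWeight x y))

/-- The pairing `⟨f, K[μ]ψ⟩` is controlled by the actions of `f` and `ψ`. -/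
theorem two_mul_pairing_le (hQ : IsNonlinearMarkovTriple K Q) (hμ : μ ∈ stdSimplex ℝ X)
    (f ψ : X → ℝ) (p : ℝ) :
    2 * p * ∑ x, f x * onsager Q μ ψ x ≤ p ^ 2 * action Q μ f + action Q μ ψ := by
  have h := hQ.action_nonneg hμ (p • f - ψ)
  have h1 : action Q μ (p • f - ψ) = p ^ 2 * action Q μ f + action Q μ ψ -
      2 * p * ∑ x, f x * onsager Q μ ψ x := by
    rw [sum_mul_onsager]
    simp only [action, Finset.mul_sum, ← Finset.sum_add_distrib, ← Finset.sum_sub_distrib,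
      Pi.sub_apply, Pi.smul_apply, smul_eq_mul]
    exact Finset.sum_congr rfl fun x _ => Finset.sum_congr rfl fun y _ => by ring
  linarith

end IsNonlinearMarkovTriple

variable {X : Type*} [Fintype X] [DecidableEq X] {K : X → (X → ℝ) → ℝ}
  {Q : (X → ℝ) → Matrix X X ℝ} {μ : X → ℝ}

/-- The derivative of the free energy at a measure of full support, up to an additive constant. -/
noncomputable def chemicalPotential (K : X → (X → ℝ) → ℝ) (μ : X → ℝ) (x : X) : ℝ :=
  Real.log (μ x) + localHamiltonian K μ x

namespace IsNonlinearMarkovTriple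

theorem rate_eq_zero_symm (hQ : IsNonlinearMarkovTriple K Q) (hμ : μ ∈ stdSimplex ℝ X) {x y : X}
    (h : Q μ x y = 0) : Q μ y x = 0 := by
  have : Nonempty X := ⟨x⟩
  have h1 := hQ.detailed_balance μ hμ x y
  rw [h, mul_zero, eq_comm, mul_eq_zero] at h1
  exact h1.resolve_left (localGibbs_pos K μ y).ne'

/-- Detailed balance gives `Q_{yx}/Q_{xy} = πₓ/π_y = exp(H_y - Hₓ)`; the partition function cancels.
-/
theorem log_flux_sub (hQ : IsNonlinearMarkovTriple K Q) (hμ : μ ∈ stdSimplex ℝ X)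
    (hpos : ∀ x, 0 < μ x) {x y : X} (h : 0 < Q μ x y) :
    Real.log (μ y * Q μ y x) - Real.log (μ x * Q μ x y) =
      chemicalPotential K μ y - chemicalPotential K μ x := by
  have : Nonempty X := ⟨x⟩
  have h' := hQ.rate_pos_symm hμ h
  have hb := congrArg Real.log (hQ.detailed_balance μ hμ x y)
  rw [Real.log_mul (localGibbs_pos K μ x).ne' h.ne', Real.log_mul (localGibbs_pos K μ y).ne' h'.ne']
    at hb
  have hZ : ∑ y, Real.exp (-localHamiltonian K μ y) ≠ 0 :=
    (Finset.sum_pos (fun _ _ => Real.exp_pos _) Finset.univ_nonempty).ne'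
  unfold localGibbs at hb
  rw [Real.log_div (Real.exp_pos _).ne' hZ, Real.log_div (Real.exp_pos _).ne' hZ, Real.log_exp,
    Real.log_exp] at hb
  rw [Real.log_mul (hpos y).ne' h'.ne', Real.log_mul (hpos x).ne' h.ne']
  unfold chemicalPotential
  linarith

theorem edgeWeight_mul_potential_sub (hQ : IsNonlinearMarkovTriple K Q)
    (hμ : μ ∈ stdSimplex ℝ X) (hpos : ∀ x, 0 < μ x) (x y : X) :
    edgeWeight Q μ x y * (chemicalPotential K μ y - chemicalPotential K μ x) =
      μ y * Q μ y x - μ x * Q μ x y := by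
  rcases eq_or_ne x y with rfl | hxy
  · simp
  rcases (hQ.rate_nonneg μ hμ x y hxy).eq_or_lt with h | h
  · simp [edgeWeight, ← h, hQ.rate_eq_zero_symm hμ h.symm, logMean_zero_zero]
  · rw [← hQ.log_flux_sub hμ hpos h]
    exact logMean_mul_log (mul_pos (hpos x) h) (mul_pos (hpos y) (hQ.rate_pos_symm hμ h))

/-- The gradient flow structure: the evolution reads `μ' = -K[μ] DF(μ)`. The outgoing part of the
net flux drops out because the rows of `Q` sum to zero. -/
theorem onsager_chemicalPotential (hQ : IsNonlinearMarkovTriple K Q)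
    (hμ : μ ∈ stdSimplex ℝ X) (hpos : ∀ x, 0 < μ x) (x : X) :
    onsager Q μ (chemicalPotential K μ) x = -(μ ᵥ* Q μ) x := by
  unfold onsager
  simp only [hQ.edgeWeight_mul_potential_sub hμ hpos, Finset.sum_sub_distrib, ← Finset.mul_sum,
    hQ.sum_rate hμ, mul_zero, sub_zero]
  rfl

/-- The Fisher information is the squared slope of the free energy. Edges without rate contribute
zero to both sides, as `Λ(0,0) = 0` and `Θ(0,0) = 0`. -/
theorem action_chemicalPotential (hQ : IsNonlinearMarkovTriple K Q)
    (hμ : μ ∈ stdSimplex ℝ X) (hpos : ∀ x, 0 < μ x) :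
    action Q μ (chemicalPotential K μ) =
      (1 / 2) * ∑ x, ∑ y, theta (μ x * Q μ x y) (μ y * Q μ y x) := by
  unfold action
  congr 1
  refine Finset.sum_congr rfl fun x _ => Finset.sum_congr rfl fun y _ => ?_
  rcases eq_or_ne x y with rfl | hxy
  · simp [theta]
  rcases (hQ.rate_nonneg μ hμ x y hxy).eq_or_lt with h | h
  · simp [edgeWeight, ← h, hQ.rate_eq_zero_symm hμ h.symm, logMean_zero_zero, theta]
  · have h1 := hQ.edgeWeight_mul_potential_sub hμ hpos x y
    have h2 := hQ.log_flux_sub hμ hpos h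
    unfold theta
    linear_combination (chemicalPotential K μ y - chemicalPotential K μ x) * h1 -
      (μ y * Q μ y x - μ x * Q μ x y) * h2

/-- A measure at which the drift does not act on the complement of the support has full support. -/
theorem pos_of_vecMul_eq_zero (hQ : IsNonlinearMarkovTriple K Q) (hμ : μ ∈ stdSimplex ℝ X)
    (h : ∀ x, μ x = 0 → (μ ᵥ* Q μ) x = 0) (x : X) : 0 < μ x := by
  have hex : ∃ a, 0 < μ a := by
    by_contra! hc
    have := Finset.sum_nonpos fun a (_ : a ∈ Finset.univ) => hc a
    linarith [hμ.2]
  obtain ⟨a, ha⟩ := hex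
  induction hQ.irreducible μ hμ a x with
  | refl => exact ha
  | @tail b c _ hbc hb =>
    -- Positivity spreads along edges: if `c` carried no mass, `(μQ)_c` would be a sum of
    -- nonnegative inflows, the diagonal term being zero, so its vanishing would forbid the positive
    -- inflow from `b`.
    refine (hμ.1 c).lt_of_ne' fun hc => ?_
    have h1 : ∑ z, μ z * Q μ z c = 0 := h c hc
    have h2 : ∀ z ∈ Finset.univ, 0 ≤ μ z * Q μ z c := by
      intro z _
      rcases eq_or_ne z c with rfl | hz
      · simp [hc]
      · exact mul_nonneg (hμ.1 z) (hQ.rate_nonneg μ hμ z c hz)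
    have h3 := (Finset.sum_eq_zero_iff_of_nonneg h2).1 h1 b (Finset.mem_univ b)
    exact (mul_pos hb hbc).ne' h3

end IsNonlinearMarkovTriple

end

/-! ### Reparametrizing and concatenating solutions of the continuity equation -/

section

theorem image_affine_unitInterval (c d : ℝ) :
    (fun r : ℝ => d + c * r) '' Set.Icc 0 1 = Set.uIcc d (d + c) := by
  rw [← segment_eq_uIcc, segment_eq_image']
  simp [mul_comm]

/-- The slope may be negative, so that time reversal is covered as well as restriction. -/
theorem setLIntegral_uIcc_eq_affine {c : ℝ} (hc : c ≠ 0) (d : ℝ) (g : ℝ → ℝ≥0∞) :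
    ∫⁻ u in Set.uIcc d (d + c), g u =
      ENNReal.ofReal |c| * ∫⁻ r in Set.Icc (0 : ℝ) 1, g (d + c * r) := by
  have hd : ∀ x ∈ Set.Icc (0 : ℝ) 1,
      HasDerivWithinAt (fun r : ℝ => d + c * r) c (Set.Icc 0 1) x := fun x _ => by
    simpa using (((hasDerivAt_id x).const_mul c).const_add d).hasDerivWithinAt
  have hinj : Set.InjOn (fun r : ℝ => d + c * r) (Set.Icc 0 1) := fun x _ y _ h => by
    simpa [hc] using h
  rw [← image_affine_unitInterval, lintegral_image_eq_lintegral_abs_deriv_mul measurableSet_Icc hd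
    hinj, lintegral_const_mul' _ _ ENNReal.ofReal_ne_top]

theorem integrableOn_uIcc_iff_affine {E : Type*} [NormedAddCommGroup E] [NormedSpace ℝ E] {c : ℝ}
    (hc : c ≠ 0) (d : ℝ) (g : ℝ → E) :
    IntegrableOn g (Set.uIcc d (d + c)) ↔
      IntegrableOn (fun r => g (d + c * r)) (Set.Icc (0 : ℝ) 1) := by
  have hd : ∀ x ∈ Set.Icc (0 : ℝ) 1,
      HasDerivWithinAt (fun r : ℝ => d + c * r) c (Set.Icc 0 1) x := fun x _ => by
    simpa using (((hasDerivAt_id x).const_mul c).const_add d).hasDerivWithinAt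
  have hinj : Set.InjOn (fun r : ℝ => d + c * r) (Set.Icc 0 1) := fun x _ y _ h => by
    simpa [hc] using h
  rw [← image_affine_unitInterval, integrableOn_image_iff_integrableOn_abs_deriv_smul
    measurableSet_Icc hd hinj]
  exact integrable_smul_iff (abs_ne_zero.2 hc) _

variable {X : Type*} [Fintype X] [DecidableEq X] {K : X → (X → ℝ) → ℝ}
  {Q : (X → ℝ) → Matrix X X ℝ}

namespace IsNonlinearMarkovTriple

theorem integrableOn_onsager (hQ : IsNonlinearMarkovTriple K Q) {μ ψ : ℝ → X → ℝ} {a b : ℝ}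
    (hm : ∀ t ∈ Set.Icc a b, μ t ∈ stdSimplex ℝ X) (hc : ContinuousOn μ (Set.Icc a b))
    (hi : IntegrableOn ψ (Set.Icc a b)) (x : X) :
    IntegrableOn (fun s => onsager Q (μ s) (ψ s) x) (Set.Icc a b) := by
  have he : ∀ y, IntegrableOn (fun s => ψ s y) (Set.Icc a b) := fun y => hi.eval y
  exact (integrable_finsetSum _ fun y _ => IntegrableOn.continuousOn_mul
    ((hQ.continuousOn_edgeWeight x y).comp hc hm) ((he y).sub (he x)) isCompact_Icc).neg

theorem aestronglyMeasurable_action (hQ : IsNonlinearMarkovTriple K Q) {μ ψ : ℝ → X → ℝ} {a b : ℝ}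
    (hm : ∀ t ∈ Set.Icc a b, μ t ∈ stdSimplex ℝ X) (hc : ContinuousOn μ (Set.Icc a b))
    (hi : IntegrableOn ψ (Set.Icc a b)) :
    AEStronglyMeasurable (fun s => action Q (μ s) (ψ s)) (volume.restrict (Set.Icc a b)) := by
  simp_rw [action_eq_sum_mul_onsager]
  exact Finset.aestronglyMeasurable_fun_sum _ fun x _ =>
    (hi.eval x).aestronglyMeasurable.mul (hQ.integrableOn_onsager hm hc hi x).aestronglyMeasurable

end IsNonlinearMarkovTriple

namespace ContinuityEquation

variable {μ ψ : ℝ → X → ℝ}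

theorem sub_eq_integral (hQ : IsNonlinearMarkovTriple K Q) (h : ContinuityEquation Q μ ψ)
    {s t : ℝ} (hs : s ∈ Set.Icc (0 : ℝ) 1) (ht : t ∈ Set.Icc (0 : ℝ) 1) (x : X) :
    μ t x - μ s x = ∫ r in s..t, onsager Q (μ r) (ψ r) x := by
  have hint : ∀ r ∈ Set.Icc (0 : ℝ) 1,
      IntervalIntegrable (fun r => onsager Q (μ r) (ψ r) x) volume 0 r := fun r hr => by
    rw [intervalIntegrable_iff_integrableOn_Icc_of_le hr.1]
    exact (hQ.integrableOn_onsager h.mem_simplex h.continuousOn h.integrableOn x).mono_set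
      (Set.Icc_subset_Icc_right hr.2)
  rw [← intervalIntegral.integral_interval_sub_left (hint t ht) (hint s hs),
    ← h.equation t ht x, ← h.equation s hs x]
  ring

/-- Restriction to the time interval between `s` and `t`, run from `s` to `t`. -/
theorem reparam (hQ : IsNonlinearMarkovTriple K Q) (h : ContinuityEquation Q μ ψ)
    {s t : ℝ} (hs : s ∈ Set.Icc (0 : ℝ) 1) (ht : t ∈ Set.Icc (0 : ℝ) 1) (hst : s ≠ t) :
    ContinuityEquation Q (fun r => μ (s + (t - s) * r))
      (fun r => (t - s) • ψ (s + (t - s) * r)) := by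
  have hmap : Set.MapsTo (fun r : ℝ => s + (t - s) * r) (Set.Icc 0 1) (Set.Icc 0 1) := by
    intro r hr
    have h1 : s + (t - s) * r ∈ Set.uIcc s (s + (t - s)) := by
      rw [← image_affine_unitInterval]
      exact ⟨r, hr, rfl⟩
    rw [add_sub_cancel] at h1
    exact Set.uIcc_subset_Icc hs ht h1
  refine ⟨fun r hr => h.mem_simplex _ (hmap hr), h.continuousOn.comp (by fun_prop) hmap, ?_, ?_⟩
  · refine Integrable.smul (t - s) (f := fun r => ψ (s + (t - s) * r)) ?_
    refine (integrableOn_uIcc_iff_affine (sub_ne_zero.2 hst.symm) s ψ).1 ?_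
    rw [add_sub_cancel]
    exact h.integrableOn.mono_set (Set.uIcc_subset_Icc hs ht)
  · intro r hr x
    simp only [onsager_smul]
    rw [mul_zero, add_zero, h.sub_eq_integral hQ hs (hmap hr), intervalIntegral.integral_const_mul]
    have := intervalIntegral.smul_integral_comp_add_mul (a := 0) (b := r)
      (fun r => onsager Q (μ r) (ψ r) x) (t - s) s
    simpa using this.symm

omit [DecidableEq X] in
-- The action is quadratic in the potential and gives `(t - s)²`; the change of variables takes back
-- one factor `|t - s|`.
theorem lintegral_action_reparam {s t : ℝ} (hst : s ≠ t) :
    ∫⁻ r in Set.Icc (0 : ℝ) 1, ENNReal.ofReal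
      (action Q (μ (s + (t - s) * r)) ((t - s) • ψ (s + (t - s) * r))) =
    ENNReal.ofReal |t - s| * ∫⁻ u in Set.uIcc s t, ENNReal.ofReal (action Q (μ u) (ψ u)) := by
  have h := setLIntegral_uIcc_eq_affine (sub_ne_zero.2 hst.symm) s
    (fun u => ENNReal.ofReal (action Q (μ u) (ψ u)))
  rw [add_sub_cancel] at h
  rw [h, ← mul_assoc, ← ENNReal.ofReal_mul (abs_nonneg _), abs_mul_abs_self, ← pow_two,
    ← lintegral_const_mul' _ _ ENNReal.ofReal_ne_top]
  simp_rw [action_smul, ENNReal.ofReal_mul (sq_nonneg (t - s))]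

/-- Concatenation of two solutions, with the times `h` and `1 - h` spent on them. -/
theorem exists_glue (hQ : IsNonlinearMarkovTriple K Q) {μ₁ ψ₁ μ₂ ψ₂ : ℝ → X → ℝ}
    (h₁ : ContinuityEquation Q μ₁ ψ₁) (h₂ : ContinuityEquation Q μ₂ ψ₂) (h12 : μ₁ 1 = μ₂ 0)
    {h : ℝ} (h0 : 0 < h) (h1 : h < 1) :
    ∃ μ ψ, ContinuityEquation Q μ ψ ∧ μ 0 = μ₁ 0 ∧ μ 1 = μ₂ 1 ∧
      ∫⁻ t in Set.Icc (0 : ℝ) 1, ENNReal.ofReal (action Q (μ t) (ψ t)) ≤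
        ENNReal.ofReal h⁻¹ * (∫⁻ t in Set.Icc (0 : ℝ) 1, ENNReal.ofReal (action Q (μ₁ t) (ψ₁ t))) +
        ENNReal.ofReal (1 - h)⁻¹ *
          (∫⁻ t in Set.Icc (0 : ℝ) 1, ENNReal.ofReal (action Q (μ₂ t) (ψ₂ t))) := by
  set k : ℝ := 1 - h with hk
  have hk0 : 0 < k := by linarith
  set μ : ℝ → X → ℝ := fun t => if t ≤ h then μ₁ (h⁻¹ * t) else μ₂ (k⁻¹ * (t - h)) with hμ
  set ψ : ℝ → X → ℝ := fun t => if t ≤ h then h⁻¹ • ψ₁ (h⁻¹ * t) else k⁻¹ • ψ₂ (k⁻¹ * (t - h))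
    with hψ
  have hμ1 : ∀ t, t ≤ h → μ t = μ₁ (h⁻¹ * t) := fun t ht => if_pos ht
  have hψ1 : ∀ t, t ≤ h → ψ t = h⁻¹ • ψ₁ (h⁻¹ * t) := fun t ht => if_pos ht
  have hμ2 : ∀ t, h ≤ t → μ t = μ₂ (k⁻¹ * (t - h)) := by
    intro t ht
    rcases ht.eq_or_lt with rfl | ht
    · rw [hμ1 _ le_rfl, inv_mul_cancel₀ h0.ne', h12, sub_self, mul_zero]
    · exact if_neg (not_le.2 ht)
  -- At the junction the two pieces of `μ` agree but those of `ψ` need not, hence the strict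
  -- inequality here and the half-open intervals below.
  have hψ2 : ∀ t, h < t → ψ t = k⁻¹ • ψ₂ (k⁻¹ * (t - h)) := fun t ht => if_neg (not_le.2 ht)
  have hmap1 : Set.MapsTo (fun t : ℝ => h⁻¹ * t) (Set.Icc 0 h) (Set.Icc 0 1) := by
    intro t ht
    refine ⟨mul_nonneg (inv_nonneg.2 h0.le) ht.1, ?_⟩
    calc h⁻¹ * t ≤ h⁻¹ * h := mul_le_mul_of_nonneg_left ht.2 (inv_nonneg.2 h0.le)
      _ = 1 := inv_mul_cancel₀ h0.ne'
  have hmap2 : Set.MapsTo (fun t : ℝ => k⁻¹ * (t - h)) (Set.Icc h 1) (Set.Icc 0 1) := by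
    intro t ht
    refine ⟨mul_nonneg (inv_nonneg.2 hk0.le) (by linarith [ht.1]), ?_⟩
    calc k⁻¹ * (t - h) ≤ k⁻¹ * k :=
          mul_le_mul_of_nonneg_left (by linarith [ht.2]) (inv_nonneg.2 hk0.le)
      _ = 1 := inv_mul_cancel₀ hk0.ne'
  have hunion : Set.Icc (0 : ℝ) 1 = Set.Icc 0 h ∪ Set.Icc h 1 :=
    (Set.Icc_union_Icc_eq_Icc h0.le h1.le).symm
  have huicc1 : Set.uIcc (0 : ℝ) (0 + h) = Set.Icc 0 h := by rw [zero_add, Set.uIcc_of_le h0.le]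
  have huicc2 : Set.uIcc h (h + k) = Set.Icc h 1 := by
    rw [hk, add_sub_cancel, Set.uIcc_of_le h1.le]
  have hmem : ∀ t ∈ Set.Icc (0 : ℝ) 1, μ t ∈ stdSimplex ℝ X := by
    intro t ht
    rcases le_total t h with hth | hth
    · rw [hμ1 t hth]; exact h₁.mem_simplex _ (hmap1 ⟨ht.1, hth⟩)
    · rw [hμ2 t hth]; exact h₂.mem_simplex _ (hmap2 ⟨hth, ht.2⟩)
  have hcont : ContinuousOn μ (Set.Icc 0 1) := by
    rw [hunion]
    refine ContinuousOn.union_of_isClosed ?_ ?_ isClosed_Icc isClosed_Icc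
    · exact (h₁.continuousOn.comp (by fun_prop) hmap1).congr fun t ht => hμ1 t ht.2
    · exact (h₂.continuousOn.comp (by fun_prop) hmap2).congr fun t ht => hμ2 t ht.1
  have hint : IntegrableOn ψ (Set.Icc 0 1) := by
    rw [hunion]
    refine IntegrableOn.union ?_ ?_
    · rw [← huicc1, integrableOn_uIcc_iff_affine h0.ne']
      refine IntegrableOn.congr_fun (Integrable.smul h⁻¹ h₁.integrableOn) (fun r hr => ?_) measurableSet_Icc
      have : h * r ≤ h := by nlinarith [hr.2]
      simp only [zero_add, hψ1 _ this, inv_mul_cancel_left₀ h0.ne', Pi.smul_apply]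
    · rw [integrableOn_Icc_iff_integrableOn_Ioc]
      have : IntegrableOn (fun t => k⁻¹ • ψ₂ (k⁻¹ * (t - h))) (Set.Icc h 1) := by
        rw [← huicc2, integrableOn_uIcc_iff_affine hk0.ne']
        refine IntegrableOn.congr_fun (Integrable.smul k⁻¹ h₂.integrableOn) (fun r _ => ?_) measurableSet_Icc
        simp only [add_sub_cancel_left, inv_mul_cancel_left₀ hk0.ne', Pi.smul_apply]
      exact (this.mono_set Set.Ioc_subset_Icc_self).congr_fun (fun r hr => (hψ2 r hr.1).symm)
        measurableSet_Ioc
  have hzero : μ 0 = μ₁ 0 := by rw [hμ1 0 h0.le, mul_zero]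
  have hone : μ 1 = μ₂ 1 := by rw [hμ2 1 h1.le, ← hk, inv_mul_cancel₀ hk0.ne']
  have heq1 : ∀ t ∈ Set.Icc 0 h, ∀ x, μ t x - μ 0 x = ∫ s in (0 : ℝ)..t, onsager Q (μ s) (ψ s) x := by
    intro t ht x
    rw [hzero, hμ1 t ht.2, h₁.equation _ (hmap1 ht) x]
    have := intervalIntegral.smul_integral_comp_add_mul (a := 0) (b := t)
      (fun r => onsager Q (μ₁ r) (ψ₁ r) x) h⁻¹ 0
    simp only [mul_zero, zero_add, smul_eq_mul, ← intervalIntegral.integral_const_mul] at this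
    rw [← this]
    refine intervalIntegral.integral_congr fun s hs => ?_
    rw [Set.uIcc_of_le ht.1] at hs
    simp only [hμ1 s (hs.2.trans ht.2), hψ1 s (hs.2.trans ht.2), onsager_smul]
  have heq2 : ∀ t ∈ Set.Icc h 1, ∀ x, μ t x - μ h x = ∫ s in h..t, onsager Q (μ s) (ψ s) x := by
    intro t ht x
    rw [hμ2 h le_rfl, hμ2 t ht.1, sub_self, mul_zero, h₂.equation _ (hmap2 ht) x]
    have := intervalIntegral.smul_integral_comp_add_mul (a := h) (b := t)
      (fun r => onsager Q (μ₂ r) (ψ₂ r) x) k⁻¹ (-(k⁻¹ * h))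
    simp only [smul_eq_mul, ← intervalIntegral.integral_const_mul] at this
    rw [neg_add_cancel, show -(k⁻¹ * h) + k⁻¹ * t = k⁻¹ * (t - h) by ring] at this
    rw [← this]
    refine intervalIntegral.integral_congr_ae (Eventually.of_forall fun s hs => ?_)
    rw [Set.uIoc_of_le ht.1] at hs
    rw [show -(k⁻¹ * h) + k⁻¹ * s = k⁻¹ * (s - h) by ring, hμ2 s hs.1.le, hψ2 s hs.1, onsager_smul]
  refine ⟨μ, ψ, ⟨hmem, hcont, hint, fun t ht x => ?_⟩, hzero, hone, ?_⟩
  · rcases le_total t h with hth | hth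
    · exact heq1 t ⟨ht.1, hth⟩ x
    · have hI := hQ.integrableOn_onsager hmem hcont hint x
      rw [← intervalIntegral.integral_add_adjacent_intervals (b := h),
        ← heq1 h ⟨h0.le, le_rfl⟩ x, ← heq2 t ⟨hth, ht.2⟩ x]
      · ring
      · rw [intervalIntegrable_iff_integrableOn_Icc_of_le h0.le]
        exact hI.mono_set (Set.Icc_subset_Icc_right h1.le)
      · rw [intervalIntegrable_iff_integrableOn_Icc_of_le hth]
        exact hI.mono_set (Set.Icc_subset_Icc h0.le ht.2)
  · refine (lintegral_mono_set (Set.Icc_union_Ioc_eq_Icc h0.le h1.le).ge).trans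
      ((lintegral_union_le _ _ _).trans (add_le_add ?_ ?_))
    · rw [← huicc1, setLIntegral_uIcc_eq_affine h0.ne', abs_of_pos h0]
      refine le_of_eq ?_
      rw [← lintegral_const_mul' _ _ ENNReal.ofReal_ne_top,
        ← lintegral_const_mul' _ _ ENNReal.ofReal_ne_top]
      refine setLIntegral_congr_fun measurableSet_Icc fun r hr => ?_
      have : h * r ≤ h := by nlinarith [hr.2]
      simp only [zero_add, hμ1 _ this, hψ1 _ this, inv_mul_cancel_left₀ h0.ne', action_smul]
      rw [← ENNReal.ofReal_mul h0.le, ← ENNReal.ofReal_mul (inv_nonneg.2 h0.le)]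
      congr 1
      field_simp
    · have e : ∫⁻ t in Set.Ioc h 1, ENNReal.ofReal (action Q (μ t) (ψ t)) =
          ∫⁻ t in Set.Ioc h 1, ENNReal.ofReal
            (action Q (μ₂ (k⁻¹ * (t - h))) (k⁻¹ • ψ₂ (k⁻¹ * (t - h)))) :=
        setLIntegral_congr_fun measurableSet_Ioc fun t ht => by
          simp only [hμ2 t ht.1.le, hψ2 t ht.1]
      rw [e]
      refine (lintegral_mono_set Set.Ioc_subset_Icc_self).trans (le_of_eq ?_)
      rw [← huicc2, setLIntegral_uIcc_eq_affine hk0.ne', abs_of_pos hk0,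
        ← lintegral_const_mul' _ _ ENNReal.ofReal_ne_top,
        ← lintegral_const_mul' _ _ ENNReal.ofReal_ne_top]
      refine setLIntegral_congr_fun measurableSet_Icc fun r hr => ?_
      simp only [add_sub_cancel_left, inv_mul_cancel_left₀ hk0.ne', action_smul]
      rw [← ENNReal.ofReal_mul hk0.le, ← ENNReal.ofReal_mul (inv_nonneg.2 hk0.le)]
      congr 1
      field_simp

end ContinuityEquation

end

/-! ### The transport distance: metric properties and lower bounds -/

section

variable {X : Type*} [Fintype X] [DecidableEq X] {K : X → (X → ℝ) → ℝ}
  {Q : (X → ℝ) → Matrix X X ℝ}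

namespace ContinuityEquation

variable {μ ψ : ℝ → X → ℝ}

theorem integrableOn_action (hQ : IsNonlinearMarkovTriple K Q) (h : ContinuityEquation Q μ ψ)
    (hE : ∫⁻ t in Set.Icc (0 : ℝ) 1, ENNReal.ofReal (action Q (μ t) (ψ t)) ≠ ⊤) :
    IntegrableOn (fun t => action Q (μ t) (ψ t)) (Set.Icc 0 1) := by
  refine (lintegral_ofReal_ne_top_iff_integrable
    (hQ.aestronglyMeasurable_action h.mem_simplex h.continuousOn h.integrableOn) ?_).1 hE
  filter_upwards [ae_restrict_mem measurableSet_Icc] with t ht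
  exact hQ.action_nonneg (h.mem_simplex t ht) _

theorem lintegral_action_eq (hQ : IsNonlinearMarkovTriple K Q) (h : ContinuityEquation Q μ ψ)
    (hE : ∫⁻ t in Set.Icc (0 : ℝ) 1, ENNReal.ofReal (action Q (μ t) (ψ t)) ≠ ⊤)
    {s t : ℝ} (hs : 0 ≤ s) (hst : s ≤ t) (ht : t ≤ 1) :
    ∫⁻ r in Set.Icc s t, ENNReal.ofReal (action Q (μ r) (ψ r)) =
      ENNReal.ofReal (∫ r in s..t, action Q (μ r) (ψ r)) := by
  rw [intervalIntegral.integral_of_le hst, ← integral_Icc_eq_integral_Ioc,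
    ofReal_integral_eq_lintegral_ofReal]
  · exact (h.integrableOn_action hQ hE).mono_set (Set.Icc_subset_Icc hs ht)
  · filter_upwards [ae_restrict_mem measurableSet_Icc] with r hr
    exact hQ.action_nonneg (h.mem_simplex r ⟨hs.trans hr.1, hr.2.trans ht⟩) _

/-- The increment of a linear functional is controlled by the total action. -/
theorem abs_sum_mul_sub_le (hQ : IsNonlinearMarkovTriple K Q) (h : ContinuityEquation Q μ ψ)
    {f : X → ℝ} {M E : ℝ} (hM : ∀ t ∈ Set.Icc (0 : ℝ) 1, action Q (μ t) f ≤ M) (hE0 : 0 ≤ E)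
    (hE : ∫⁻ t in Set.Icc (0 : ℝ) 1, ENNReal.ofReal (action Q (μ t) (ψ t)) ≤ ENNReal.ofReal E) :
    |∑ x, f x * (μ 1 x - μ 0 x)| ≤ √(M * E) := by
  have hE' := ne_top_of_le_ne_top ENNReal.ofReal_ne_top hE
  have hA : IntervalIntegrable (fun t => action Q (μ t) (ψ t)) volume 0 1 := by
    rw [intervalIntegrable_iff_integrableOn_Icc_of_le zero_le_one]
    exact h.integrableOn_action hQ hE'
  have hO : ∀ x, IntervalIntegrable (fun t => onsager Q (μ t) (ψ t) x) volume 0 1 := fun x => by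
    rw [intervalIntegrable_iff_integrableOn_Icc_of_le zero_le_one]
    exact hQ.integrableOn_onsager h.mem_simplex h.continuousOn h.integrableOn x
  have hAE : ∫ t in (0 : ℝ)..1, action Q (μ t) (ψ t) ≤ E := by
    rw [h.lintegral_action_eq hQ hE' le_rfl zero_le_one le_rfl] at hE
    exact (ENNReal.ofReal_le_ofReal_iff hE0).1 hE
  set L := ∑ x, f x * (μ 1 x - μ 0 x) with hL
  have hLint : L = ∫ t in (0 : ℝ)..1, ∑ x, f x * onsager Q (μ t) (ψ t) x := by
    rw [intervalIntegral.integral_finsetSum fun x _ => (hO x).const_mul (f x)]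
    simp_rw [intervalIntegral.integral_const_mul]
    exact Finset.sum_congr rfl fun x _ => by rw [h.equation 1 ⟨zero_le_one, le_rfl⟩ x]
  -- Cauchy-Schwarz in time and space at once: this quadratic in `p` is nonnegative, so its
  -- discriminant gives `L² ≤ M E`.
  have key : ∀ p : ℝ, 0 ≤ M * (p * p) + (-(2 * L)) * p + E := by
    intro p
    have hS : IntervalIntegrable (fun t => ∑ x, f x * onsager Q (μ t) (ψ t) x) volume 0 1 := by
      simpa only [Finset.sum_fn] using IntervalIntegrable.sum (μ := volume) (a := 0) (b := 1)
        Finset.univ (f := fun x t => f x * onsager Q (μ t) (ψ t) x)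
        fun x _ => (hO x).const_mul (f x)
    have h1 : 2 * p * L ≤ p ^ 2 * M + E := by
      calc 2 * p * L = ∫ t in (0 : ℝ)..1, 2 * p * ∑ x, f x * onsager Q (μ t) (ψ t) x := by
            rw [intervalIntegral.integral_const_mul, ← hLint]
        _ ≤ ∫ t in (0 : ℝ)..1, (p ^ 2 * M + action Q (μ t) (ψ t)) := by
            refine intervalIntegral.integral_mono_on zero_le_one (hS.const_mul _)
              (intervalIntegrable_const.add hA) fun t ht => ?_
            refine (hQ.two_mul_pairing_le (h.mem_simplex t ht) f (ψ t) p).trans ?_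
            gcongr
            exact hM t ht
        _ = p ^ 2 * M + ∫ t in (0 : ℝ)..1, action Q (μ t) (ψ t) := by
            rw [intervalIntegral.integral_add intervalIntegrable_const hA]
            simp
        _ ≤ p ^ 2 * M + E := by gcongr
    linarith
  have hd := discrim_le_zero key
  unfold discrim at hd
  refine Real.abs_le_sqrt ?_
  linarith

end ContinuityEquation

omit [DecidableEq X] in
theorem transportDist_le {μ ψ : ℝ → X → ℝ} (h : ContinuityEquation Q μ ψ) {E : ℝ}
    (hE : ∫⁻ t in Set.Icc (0 : ℝ) 1, ENNReal.ofReal (action Q (μ t) (ψ t)) ≤ ENNReal.ofReal E) :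
    transportDist Q (μ 0) (μ 1) ≤ ENNReal.ofReal √E := by
  refine (iInf₂_le (μ, ψ) ⟨h, rfl, rfl⟩).trans ?_
  rcases le_total 0 E with hE0 | hE0
  · rw [Real.sqrt_eq_rpow, ← ENNReal.ofReal_rpow_of_nonneg hE0 (by norm_num)]
    exact ENNReal.rpow_le_rpow hE (by norm_num)
  · rw [ENNReal.ofReal_of_nonpos hE0] at hE
    simp [le_antisymm hE zero_le]

omit [DecidableEq X] in
theorem exists_of_transportDist_lt {μ₀ μ₁ : X → ℝ} {r : ℝ}
    (h : transportDist Q μ₀ μ₁ < ENNReal.ofReal r) :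
    ∃ μ ψ, ContinuityEquation Q μ ψ ∧ μ 0 = μ₀ ∧ μ 1 = μ₁ ∧
      ∫⁻ t in Set.Icc (0 : ℝ) 1, ENNReal.ofReal (action Q (μ t) (ψ t)) ≤
        ENNReal.ofReal (r ^ 2) := by
  have hr : 0 < r := ENNReal.ofReal_pos.1 (pos_of_gt h)
  unfold transportDist at h
  simp only [iInf_lt_iff] at h
  obtain ⟨p, ⟨hp, hp0, hp1⟩, hlt⟩ := h
  refine ⟨p.1, p.2, hp, hp0, hp1, ?_⟩
  have := ENNReal.rpow_le_rpow hlt.le (z := 2) (by norm_num)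
  rw [← ENNReal.rpow_mul, ENNReal.ofReal_rpow_of_nonneg hr.le (by norm_num)] at this
  simpa using this

omit [DecidableEq X] in
theorem transportDist_self {μ : X → ℝ} (hμ : μ ∈ stdSimplex ℝ X) : transportDist Q μ μ = 0 := by
  have h : ContinuityEquation Q (fun _ => μ) (fun _ => 0) :=
    ⟨fun _ _ => hμ, continuousOn_const, integrableOn_zero, fun t _ x => by simp [onsager]⟩
  have := transportDist_le h (E := 0) (by simp [action])
  simpa using this

/-- Running a curve backwards, with `ψ` negated, leaves its action unchanged. -/
theorem transportDist_comm (hQ : IsNonlinearMarkovTriple K Q) (μ₀ μ₁ : X → ℝ) :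
    transportDist Q μ₀ μ₁ = transportDist Q μ₁ μ₀ := by
  have key : ∀ ν₀ ν₁ : X → ℝ, transportDist Q ν₁ ν₀ ≤ transportDist Q ν₀ ν₁ := by
    intro ν₀ ν₁
    refine le_iInf₂ fun p hp => ?_
    have h := hp.1.reparam hQ (s := 1) (t := 0) (by simp) (by simp) one_ne_zero
    have hc := ContinuityEquation.lintegral_action_reparam (Q := Q) (μ := p.1) (ψ := p.2)
      (s := 1) (t := 0) one_ne_zero
    have h1 : p.1 (1 + (0 - 1) * 0) = ν₁ := by simpa using hp.2.2
    have h0 : p.1 (1 + (0 - 1) * 1) = ν₀ := by simpa using hp.2.1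
    exact (iInf₂_le (fun r => p.1 (1 + (0 - 1) * r),
      fun r => (0 - 1 : ℝ) • p.2 (1 + (0 - 1) * r)) ⟨h, h1, h0⟩).trans
      (ENNReal.rpow_le_rpow (hc.trans (by simp)).le (by norm_num))
  exact le_antisymm (key _ _) (key _ _)

theorem transportDist_triangle (hQ : IsNonlinearMarkovTriple K Q) (μ₀ μ₁ μ₂ : X → ℝ) :
    transportDist Q μ₀ μ₂ ≤ transportDist Q μ₀ μ₁ + transportDist Q μ₁ μ₂ := by
  by_cases h1 : transportDist Q μ₀ μ₁ = ⊤
  · simp [h1]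
  by_cases h2 : transportDist Q μ₁ μ₂ = ⊤
  · simp [h2]
  refine ENNReal.le_of_forall_pos_le_add fun ε hε _ => ?_
  have hε' : (0 : ℝ) < ε := hε
  set a := (transportDist Q μ₀ μ₁).toReal + ε / 2 with ha
  set b := (transportDist Q μ₁ μ₂).toReal + ε / 2 with hb
  have ha0 : 0 < a := by positivity
  have hb0 : 0 < b := by positivity
  obtain ⟨η₁, ψ₁, c₁, e₁, e₁', E₁⟩ := exists_of_transportDist_lt (Q := Q) (μ₀ := μ₀) (μ₁ := μ₁)
    (r := a) ((ENNReal.lt_ofReal_iff_toReal_lt h1).2 (by linarith))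
  obtain ⟨η₂, ψ₂, c₂, e₂, e₂', E₂⟩ := exists_of_transportDist_lt (Q := Q) (μ₀ := μ₁) (μ₁ := μ₂)
    (r := b) ((ENNReal.lt_ofReal_iff_toReal_lt h2).2 (by linarith))
  have hh : 1 - a / (a + b) = b / (a + b) := by field_simp; ring
  -- Time is shared in proportion to length: `a²/h + b²/(1 - h)` attains its minimum `(a + b)²` at
  -- `h = a/(a + b)`.
  obtain ⟨η, ψ, c, e, e', E⟩ := c₁.exists_glue hQ c₂ (e₁'.trans e₂.symm) (h := a / (a + b))
    (by positivity) ((div_lt_one (by positivity)).2 (by linarith))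
  have hE : ∫⁻ t in Set.Icc (0 : ℝ) 1, ENNReal.ofReal (action Q (η t) (ψ t)) ≤
      ENNReal.ofReal ((a + b) ^ 2) := by
    refine E.trans ((add_le_add (mul_le_mul_right E₁ _) (mul_le_mul_right E₂ _)).trans
      (le_of_eq ?_))
    rw [hh, ← ENNReal.ofReal_mul (by positivity), ← ENNReal.ofReal_mul (by positivity),
      ← ENNReal.ofReal_add (by positivity) (by positivity)]
    congr 1
    field_simp
  have := transportDist_le c hE
  rw [e, e', e₁, e₂', Real.sqrt_sq (by positivity)] at this
  refine this.trans (le_of_eq ?_)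
  have hab : a + b =
      (transportDist Q μ₀ μ₁).toReal + (transportDist Q μ₁ μ₂).toReal + ε := by rw [ha, hb]; ring
  rw [hab, ENNReal.ofReal_add (by positivity) (by positivity),
    ENNReal.ofReal_add (by positivity) (by positivity), ENNReal.ofReal_toReal h1,
    ENNReal.ofReal_toReal h2, ENNReal.ofReal_coe_nnreal]

namespace ContinuityEquation

variable {μ ψ : ℝ → X → ℝ}

/-- The piece between `s` and `t`, rescaled to unit time, is a competitor. -/
theorem transportDist_le_sqrt_integral (hQ : IsNonlinearMarkovTriple K Q)
    (h : ContinuityEquation Q μ ψ)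
    (hE : ∫⁻ t in Set.Icc (0 : ℝ) 1, ENNReal.ofReal (action Q (μ t) (ψ t)) ≠ ⊤)
    {s t : ℝ} (hs : 0 ≤ s) (hst : s ≤ t) (ht : t ≤ 1) :
    transportDist Q (μ s) (μ t) ≤
      ENNReal.ofReal √((t - s) * ∫ r in s..t, action Q (μ r) (ψ r)) := by
  rcases hst.eq_or_lt with rfl | hlt
  · rw [transportDist_self (h.mem_simplex s ⟨hs, ht⟩)]
    exact zero_le
  · have hc := h.reparam hQ (s := s) (t := t) ⟨hs, hst.trans ht⟩ ⟨hs.trans hst, ht⟩ hlt.ne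
    have := transportDist_le hc (E := (t - s) * ∫ r in s..t, action Q (μ r) (ψ r)) (by
      rw [lintegral_action_reparam hlt.ne, Set.uIcc_of_le hst, abs_of_pos (sub_pos.2 hlt),
        h.lintegral_action_eq hQ hE hs hst ht, ENNReal.ofReal_mul (sub_pos.2 hlt).le])
    simpa using this

theorem transportDist_zero_le (hQ : IsNonlinearMarkovTriple K Q)
    (h : ContinuityEquation Q μ ψ) {E : ℝ} (hE0 : 0 ≤ E)
    (hE : ∫⁻ t in Set.Icc (0 : ℝ) 1, ENNReal.ofReal (action Q (μ t) (ψ t)) ≤ ENNReal.ofReal E)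
    {t : ℝ} (h0 : 0 ≤ t) (h1 : t ≤ 1) :
    transportDist Q (μ 0) (μ t) ≤ ENNReal.ofReal √(t * E) := by
  have hE' := ne_top_of_le_ne_top ENNReal.ofReal_ne_top hE
  refine (h.transportDist_le_sqrt_integral hQ hE' le_rfl h0 h1).trans ?_
  refine ENNReal.ofReal_le_ofReal (Real.sqrt_le_sqrt ?_)
  rw [sub_zero]
  refine mul_le_mul_of_nonneg_left ?_ h0
  rw [← ENNReal.ofReal_le_ofReal_iff hE0, ← h.lintegral_action_eq hQ hE' le_rfl h0 h1]
  exact (lintegral_mono_set (Set.Icc_subset_Icc_right h1)).trans hE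

end ContinuityEquation

/-- The transport distance dominates the increments of linear functionals. -/
theorem exists_abs_sub_le_transportDist (hQ : IsNonlinearMarkovTriple K Q) :
    ∃ C : ℝ, 0 ≤ C ∧ ∀ μ ν : X → ℝ, transportDist Q μ ν ≠ ⊤ →
      ∀ x, |ν x - μ x| ≤ C * (transportDist Q μ ν).toReal := by
  have hb : ∀ x : X, ∃ M, ∀ μ ∈ stdSimplex ℝ X, action Q μ (Pi.single x 1) ≤ M := fun x => by
    obtain ⟨M, hM⟩ := (isCompact_stdSimplex ℝ X).bddAbove_image
      (hQ.continuousOn_action (Pi.single x 1))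
    exact ⟨M, fun μ hμ => hM ⟨μ, hμ, rfl⟩⟩
  choose M hM using hb
  refine ⟨√(∑ x, |M x|), Real.sqrt_nonneg _, fun μ ν hfin x => ?_⟩
  refine le_of_forall_pos_le_add fun ε hε => ?_
  set S := √(∑ x, |M x|)
  have hS0 : 0 ≤ S := Real.sqrt_nonneg _
  -- The infimum need not be attained; this slack costs at most `ε` after multiplication by `S`.
  have hδ : 0 < ε / (S + 1) := by positivity
  set r := (transportDist Q μ ν).toReal + ε / (S + 1) with hr
  have hr0 : 0 < r := by positivity
  obtain ⟨η, ψ, c, e, e', E⟩ := exists_of_transportDist_lt (Q := Q) (μ₀ := μ) (μ₁ := ν)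
    (r := r) ((ENNReal.lt_ofReal_iff_toReal_lt hfin).2 (by linarith))
  have h := c.abs_sum_mul_sub_le hQ (f := Pi.single x 1) (M := ∑ x, |M x|) (fun t ht =>
    (hM x _ (c.mem_simplex t ht)).trans ((le_abs_self _).trans
      (Finset.single_le_sum (f := fun x => |M x|) (fun _ _ => abs_nonneg _) (Finset.mem_univ x))))
    (sq_nonneg r) E
  rw [Real.sqrt_mul (Finset.sum_nonneg fun _ _ => abs_nonneg _), Real.sqrt_sq hr0.le, e, e'] at h
  simp only [Pi.single_apply, ite_mul, one_mul, zero_mul, Finset.sum_ite_eq',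
    Finset.mem_univ, if_true] at h
  refine h.trans ?_
  have : S * (ε / (S + 1)) ≤ ε := by
    rw [mul_div_assoc', div_le_iff₀ (by positivity)]
    nlinarith
  rw [hr, mul_add]
  linarith

end

/-! ### Coercivity of the action and upper bounds for the distance in the interior -/

section

variable {X : Type*} [Fintype X] [DecidableEq X] {K : X → (X → ℝ) → ℝ}
  {Q : (X → ℝ) → Matrix X X ℝ}

/-- A Poincaré inequality, uniform over the simplex. -/
theorem exists_poincare (hQ : IsNonlinearMarkovTriple K Q) :
    ∃ c : ℝ, 0 < c ∧ ∀ μ ∈ stdSimplex ℝ X, ∀ ψ : X → ℝ, ∑ x, ψ x = 0 →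
      c * ∑ x, ψ x ^ 2 ≤ 1 / 2 * ∑ x, ∑ y, (ψ y - ψ x) ^ 2 * √(Q μ x y * Q μ y x) := by
  set T : Set (X → ℝ) := {ψ | ∑ x, ψ x = 0 ∧ ∑ x, ψ x ^ 2 = 1} with hT
  have hTc : IsCompact T := by
    refine (isCompact_Icc (a := fun _ : X => (-1 : ℝ)) (b := fun _ => 1)).of_isClosed_subset
      (IsClosed.inter (isClosed_eq (by fun_prop) continuous_const)
        (isClosed_eq (by fun_prop) continuous_const)) fun ψ hψ => ?_
    have h : ∀ x, |ψ x| ≤ 1 := fun x => by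
      rw [← sq_le_one_iff_abs_le_one, ← hψ.2]
      exact Finset.single_le_sum (f := fun x => ψ x ^ 2) (fun _ _ => sq_nonneg _)
        (Finset.mem_univ x)
    exact ⟨fun x => (abs_le.1 (h x)).1, fun x => (abs_le.1 (h x)).2⟩
  -- Only the rates enter this form, not the masses, so it does not degenerate at the boundary. It
  -- is continuous on a compact product and positive there by irreducibility; its minimum is the
  -- constant, and homogeneity does the rest.
  set F : (X → ℝ) × (X → ℝ) → ℝ := fun p =>
    1 / 2 * ∑ x, ∑ y, (p.2 y - p.2 x) ^ 2 * √(Q p.1 x y * Q p.1 y x) with hF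
  have hFc : ContinuousOn F (stdSimplex ℝ X ×ˢ T) := by
    refine continuousOn_const.mul (continuousOn_finsetSum _ fun x _ =>
      continuousOn_finsetSum _ fun y _ => ContinuousOn.mul (by fun_prop) ?_)
    exact Real.continuous_sqrt.comp_continuousOn
      (((hQ.continuousOn_rate x y).mul (hQ.continuousOn_rate y x)).comp continuousOn_fst
        fun p hp => hp.1)
  have hpos : ∀ p ∈ stdSimplex ℝ X ×ˢ T, 0 < F p := by
    rintro ⟨μ, ψ⟩ ⟨hμ, hψ⟩
    have hnn : ∀ x y, 0 ≤ (ψ y - ψ x) ^ 2 * √(Q μ x y * Q μ y x) := fun x y => by positivity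
    have h0 : 0 ≤ F (μ, ψ) := mul_nonneg (by norm_num)
      (Finset.sum_nonneg fun x _ => Finset.sum_nonneg fun y _ => hnn x y)
    refine h0.lt_of_ne' fun hz => ?_
    have hz' : ∑ x, ∑ y, (ψ y - ψ x) ^ 2 * √(Q μ x y * Q μ y x) = 0 := by
      simpa [hF] using hz
    have hedge : ∀ x y, 0 < Q μ x y → ψ x = ψ y := fun x y h => by
      have h1 := (Finset.sum_eq_zero_iff_of_nonneg
        fun x _ => Finset.sum_nonneg fun y _ => hnn x y).1 hz' x (Finset.mem_univ x)
      have h2 := (Finset.sum_eq_zero_iff_of_nonneg fun y _ => hnn x y).1 h1 y (Finset.mem_univ y)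
      have h3 : √(Q μ x y * Q μ y x) ≠ 0 :=
        (Real.sqrt_pos.2 (mul_pos h (hQ.rate_pos_symm hμ h))).ne'
      have h4 := (mul_eq_zero.1 h2).resolve_right h3
      linarith [pow_eq_zero_iff (two_ne_zero) |>.1 h4]
    have hconst : ∀ x y, ψ x = ψ y := fun x y => by
      induction hQ.irreducible μ hμ x y with
      | refl => rfl
      | tail _ h ih => exact ih.trans (hedge _ _ h)
    have hzero : ∀ x, ψ x = 0 := fun x => by
      have h1 : ∑ y, ψ y = Fintype.card X * ψ x := by
        rw [Finset.sum_congr rfl fun y _ => hconst y x]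
        simp
      rw [hψ.1] at h1
      have : Nonempty X := ⟨x⟩
      have : (Fintype.card X : ℝ) ≠ 0 := by exact_mod_cast Fintype.card_ne_zero
      exact (mul_eq_zero.1 h1.symm).resolve_left this
    have := hψ.2
    simp [hzero] at this
  obtain ⟨c, hc, hcF⟩ : ∃ c : ℝ, 0 < c ∧ ∀ p ∈ stdSimplex ℝ X ×ˢ T, c ≤ F p := by
    -- With at most one state `T` is empty, and any constant serves.
    rcases (stdSimplex ℝ X ×ˢ T).eq_empty_or_nonempty with he | hne
    · exact ⟨1, one_pos, by simp [he]⟩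
    · obtain ⟨p, hp, hmin⟩ := ((isCompact_stdSimplex ℝ X).prod hTc).exists_isMinOn hne hFc
      exact ⟨F p, hpos p hp, fun q hq => hmin hq⟩
  refine ⟨c, hc, fun μ hμ ψ hψ => ?_⟩
  have hs0 : 0 ≤ ∑ x, ψ x ^ 2 := Finset.sum_nonneg fun _ _ => sq_nonneg _
  rcases hs0.eq_or_lt with h | h
  · rw [← h, mul_zero]
    exact mul_nonneg (by norm_num)
      (Finset.sum_nonneg fun x _ => Finset.sum_nonneg fun y _ => by positivity)
  · set a := √(∑ x, ψ x ^ 2) with ha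
    have ha0 : 0 < a := Real.sqrt_pos.2 h
    have ha2 : a ^ 2 = ∑ x, ψ x ^ 2 := Real.sq_sqrt hs0
    have hmem : (fun x => ψ x / a) ∈ T := by
      refine ⟨by rw [← Finset.sum_div, hψ, zero_div], ?_⟩
      simp_rw [div_pow]
      rw [← Finset.sum_div, ← ha2, div_self (by positivity)]
    have h1 := hcF (μ, fun x => ψ x / a) ⟨hμ, hmem⟩
    have h2 : F (μ, fun x => ψ x / a) =
        (1 / 2 * ∑ x, ∑ y, (ψ y - ψ x) ^ 2 * √(Q μ x y * Q μ y x)) / a ^ 2 := by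
      simp only [hF, Finset.mul_sum, Finset.sum_div]
      refine Finset.sum_congr rfl fun x _ => Finset.sum_congr rfl fun y _ => ?_
      field_simp
    rw [h2, le_div_iff₀ (by positivity), ha2] at h1
    exact h1

/-- Since `√(μₓ μ_y) ≥ m`, the uniform Poincaré inequality bounds the action from below. The
constant is linear in the least mass `m`, which the choice of curves below exploits. -/
theorem exists_mul_sum_sq_le_action (hQ : IsNonlinearMarkovTriple K Q) :
    ∃ c : ℝ, 0 < c ∧ ∀ μ ∈ stdSimplex ℝ X, ∀ m : ℝ, 0 ≤ m → (∀ x, m ≤ μ x) →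
      ∀ ψ : X → ℝ, ∑ x, ψ x = 0 → c * m * ∑ x, ψ x ^ 2 ≤ action Q μ ψ := by
  obtain ⟨c, hc, h⟩ := exists_poincare hQ
  refine ⟨c, hc, fun μ hμ m hm hmμ ψ hψ => ?_⟩
  have h1 := mul_le_mul_of_nonneg_left (h μ hμ ψ hψ) hm
  have h2 : m * (1 / 2 * ∑ x, ∑ y, (ψ y - ψ x) ^ 2 * √(Q μ x y * Q μ y x)) ≤ action Q μ ψ := by
    rw [mul_left_comm]
    refine mul_le_mul_of_nonneg_left ?_ (by norm_num)
    simp only [Finset.mul_sum]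
    refine Finset.sum_le_sum fun x _ => Finset.sum_le_sum fun y _ => ?_
    rcases eq_or_ne x y with rfl | hxy
    · simp
    · rw [mul_left_comm]
      refine mul_le_mul_of_nonneg_left (le_trans ?_ (hQ.sqrt_mul_sqrt_le_edgeWeight hμ hxy))
        (sq_nonneg _)
      refine mul_le_mul_of_nonneg_right (Real.le_sqrt_of_sq_le ?_) (Real.sqrt_nonneg _)
      nlinarith [hmμ x, hmμ y]
  linarith

/-- The matrix of `ψ ↦ K[μ]ψ + (∑ ψ) 1`. -/
noncomputable def onsagerMatrix (Q : (X → ℝ) → Matrix X X ℝ) (μ : X → ℝ) : Matrix X X ℝ :=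
  Matrix.of fun x y => 1 - edgeWeight Q μ x y + if x = y then ∑ z, edgeWeight Q μ x z else 0

theorem onsagerMatrix_mulVec (Q : (X → ℝ) → Matrix X X ℝ) (μ ψ : X → ℝ) (x : X) :
    (onsagerMatrix Q μ *ᵥ ψ) x = onsager Q μ ψ x + ∑ y, ψ y := by
  simp only [Matrix.mulVec, dotProduct, onsagerMatrix, Matrix.of_apply, add_mul, sub_mul, one_mul,
    Finset.sum_add_distrib, Finset.sum_sub_distrib, ite_mul, zero_mul, Finset.sum_ite_eq,
    Finset.mem_univ, if_true, onsager, mul_sub, Finset.sum_mul]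
  ring

/-- On the kernel, summing the coordinates gives `∑ ψ = 0`, because `K[μ]ψ` has zero sum; then the
action of `ψ` vanishes and coercivity gives `ψ = 0`. The added rank-one term only removes the
constants from the kernel of `K[μ]`. -/
theorem isUnit_onsagerMatrix (hQ : IsNonlinearMarkovTriple K Q) {μ : X → ℝ}
    (hμ : μ ∈ stdSimplex ℝ X) (hpos : ∀ x, 0 < μ x) : IsUnit (onsagerMatrix Q μ) := by
  obtain ⟨c, hc, h⟩ := exists_mul_sum_sq_le_action hQ
  rw [← Matrix.mulVec_injective_iff_isUnit, ← Matrix.coe_mulVecLin, ← LinearMap.ker_eq_bot,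
    LinearMap.ker_eq_bot']
  intro ψ hψ
  have hψ' : ∀ x, onsager Q μ ψ x + ∑ y, ψ y = 0 := fun x => by
    rw [← onsagerMatrix_mulVec]
    exact congrFun hψ x
  rcases isEmpty_or_nonempty X with hX | hX
  · exact Subsingleton.elim _ _
  have hsum : ∑ y, ψ y = 0 := by
    have h1 : ∑ x, (onsager Q μ ψ x + ∑ y, ψ y) = 0 := Finset.sum_eq_zero fun x _ => hψ' x
    rw [Finset.sum_add_distrib, sum_onsager, zero_add, Finset.sum_const, nsmul_eq_mul,
      mul_eq_zero] at h1
    exact h1.resolve_left (by simp)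
  have hact : action Q μ ψ = 0 := by
    rw [action_eq_sum_mul_onsager]
    refine Finset.sum_eq_zero fun x _ => ?_
    have := hψ' x
    rw [hsum, add_zero] at this
    rw [this, mul_zero]
  obtain ⟨z, hz⟩ := Finite.exists_min μ
  have h1 := h μ hμ (μ z) (hpos z).le hz ψ hsum
  rw [hact] at h1
  have h2 : ∑ x, ψ x ^ 2 ≤ 0 := by
    by_contra! hlt
    have : 0 < c * μ z * ∑ x, ψ x ^ 2 := mul_pos (mul_pos hc (hpos z)) hlt
    linarith
  have h3 := (Finset.sum_eq_zero_iff_of_nonneg fun x _ => sq_nonneg (ψ x)).1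
    (h2.antisymm (Finset.sum_nonneg fun _ _ => sq_nonneg _))
  ext x
  exact (pow_eq_zero_iff two_ne_zero).1 (h3 x (Finset.mem_univ x))

/-- A curve of measures of full support (for positive times) is transported by a potential. -/
theorem exists_continuityEquation (hQ : IsNonlinearMarkovTriple K Q) {η σ : ℝ → X → ℝ}
    (hη : ∀ t ∈ Set.Icc (0 : ℝ) 1, η t ∈ stdSimplex ℝ X)
    (hpos : ∀ t ∈ Set.Ioc (0 : ℝ) 1, ∀ x, 0 < η t x)
    (hd : ∀ t x, HasDerivAt (fun t => η t x) (σ t x) t) (hσ : Continuous σ)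
    (hσ0 : ∀ t, ∑ x, σ t x = 0) {E C : ℝ}
    (hb : ∀ t ∈ Set.Ioc (0 : ℝ) 1, ∀ ψ : X → ℝ, ∑ x, ψ x = 0 →
      (∀ x, onsager Q (η t) ψ x = σ t x) → action Q (η t) ψ ≤ E ∧ ∑ x, ψ x ^ 2 ≤ C) :
    ∃ ψ, ContinuityEquation Q η ψ ∧
      ∫⁻ t in Set.Icc (0 : ℝ) 1, ENNReal.ofReal (action Q (η t) (ψ t)) ≤ ENNReal.ofReal E := by
  have hηc : Continuous η := continuous_pi fun x =>
    continuous_iff_continuousAt.2 fun t => (hd t x).continuousAt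
  -- As `σ` has zero sum, this solves `K[η]ψ = σ` with `∑ ψ = 0`, and `hb` applies to it. The matrix
  -- may be singular at time 0, where `η` may touch the boundary, but one instant is negligible.
  set ψ : ℝ → X → ℝ := fun t => (onsagerMatrix Q (η t))⁻¹ *ᵥ σ t with hψ
  have hunit : ∀ t ∈ Set.Ioc (0 : ℝ) 1, IsUnit (onsagerMatrix Q (η t)) := fun t ht =>
    isUnit_onsagerMatrix hQ (hη t (Set.Ioc_subset_Icc_self ht)) (hpos t ht)
  have hmul : ∀ t ∈ Set.Ioc (0 : ℝ) 1, ∀ x, onsager Q (η t) (ψ t) x + ∑ y, ψ t y = σ t x := by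
    intro t ht x
    rw [← onsagerMatrix_mulVec, hψ]
    simp only [Matrix.mulVec_mulVec]
    rw [Matrix.mul_nonsing_inv _ ((Matrix.isUnit_iff_isUnit_det _).1 (hunit t ht)),
      Matrix.one_mulVec]
  have hsum : ∀ t ∈ Set.Ioc (0 : ℝ) 1, ∑ y, ψ t y = 0 := by
    intro t ht
    rcases isEmpty_or_nonempty X with hX | hX
    · simp
    have h1 : ∑ x, (onsager Q (η t) (ψ t) x + ∑ y, ψ t y) = 0 := by
      rw [← hσ0 t]
      exact Finset.sum_congr rfl fun x _ => hmul t ht x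
    rw [Finset.sum_add_distrib, sum_onsager, zero_add, Finset.sum_const, nsmul_eq_mul,
      mul_eq_zero] at h1
    exact h1.resolve_left (by simp)
  have hons : ∀ t ∈ Set.Ioc (0 : ℝ) 1, ∀ x, onsager Q (η t) (ψ t) x = σ t x := by
    intro t ht x
    have := hmul t ht x
    rwa [hsum t ht, add_zero] at this
  have hbd := fun t ht => hb t ht (ψ t) (hsum t ht) (hons t ht)
  have hMc : ContinuousOn (fun t => onsagerMatrix Q (η t)) (Set.Ioc 0 1) := by
    have he : ∀ x y, ContinuousOn (fun t => edgeWeight Q (η t) x y) (Set.Ioc 0 1) := fun x y =>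
      (hQ.continuousOn_edgeWeight x y).comp hηc.continuousOn
        fun t ht => hη t (Set.Ioc_subset_Icc_self ht)
    refine continuousOn_pi.2 fun x => continuousOn_pi.2 fun y => ?_
    refine (continuousOn_const.sub (he x y)).add ?_
    split_ifs
    · exact continuousOn_finsetSum _ fun z _ => he x z
    · exact continuousOn_const
  have hψc : ContinuousOn ψ (Set.Ioc 0 1) := by
    have h1 : ContinuousOn (fun t => (onsagerMatrix Q (η t))⁻¹) (Set.Ioc 0 1) := by
      simp_rw [Matrix.inv_def, Ring.inverse_eq_inv]
      refine ContinuousOn.smul (ContinuousOn.inv₀ ?_ fun t ht =>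
        ((Matrix.isUnit_iff_isUnit_det _).1 (hunit t ht)).ne_zero) ?_
      · exact (continuous_id.matrix_det).comp_continuousOn hMc
      · exact (continuous_id.matrix_adjugate).comp_continuousOn hMc
    exact (Continuous.matrix_mulVec continuous_fst continuous_snd).comp_continuousOn
      (h1.prodMk hσ.continuousOn)
  refine ⟨ψ, ⟨hη, hηc.continuousOn, ?_, ?_⟩, ?_⟩
  · rw [integrableOn_Icc_iff_integrableOn_Ioc]
    refine Integrable.of_bound (hψc.aestronglyMeasurable measurableSet_Ioc) √C ?_
    filter_upwards [ae_restrict_mem measurableSet_Ioc] with t ht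
    refine (pi_norm_le_iff_of_nonneg (Real.sqrt_nonneg _)).2 fun x => Real.abs_le_sqrt ?_
    exact (Finset.single_le_sum (f := fun x => ψ t x ^ 2) (fun _ _ => sq_nonneg _)
      (Finset.mem_univ x)).trans (hbd t ht).2
  · intro t ht x
    rw [← intervalIntegral.integral_eq_sub_of_hasDerivAt (fun s _ => hd s x)
      (((continuous_apply x).comp hσ).intervalIntegrable 0 t)]
    refine intervalIntegral.integral_congr_ae (Eventually.of_forall fun s hs => ?_)
    rw [Set.uIoc_of_le ht.1] at hs
    exact (hons s ⟨hs.1, hs.2.trans ht.2⟩ x).symm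
  · rw [setLIntegral_congr Ioc_ae_eq_Icc.symm]
    calc ∫⁻ t in Set.Ioc (0 : ℝ) 1, ENNReal.ofReal (action Q (η t) (ψ t)) ≤
          ∫⁻ _t in Set.Ioc (0 : ℝ) 1, ENNReal.ofReal E :=
          setLIntegral_mono' measurableSet_Ioc fun t ht => ENNReal.ofReal_le_ofReal (hbd t ht).1
      _ = ENNReal.ofReal E := by simp

/-- The segment is run as `μ + t² (ν - μ)`. Its velocity is of order `t` and its least mass at least
`t² m`, so the action, of order velocity² / mass, stays bounded by a constant that does not involve
the least mass of `μ`. -/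
theorem exists_transportDist_le_of_segment (hQ : IsNonlinearMarkovTriple K Q) :
    ∃ C : ℝ, 0 < C ∧ ∀ μ ∈ stdSimplex ℝ X, ∀ ν ∈ stdSimplex ℝ X, (∀ x, 0 < μ x) → (∀ x, 0 < ν x) →
      ∀ m : ℝ, 0 < m → (∀ t ∈ Set.Icc (0 : ℝ) 1, ∀ x, t ^ 2 * m ≤ μ x + t ^ 2 * (ν x - μ x)) →
      transportDist Q μ ν ≤ ENNReal.ofReal √(C * (∑ x, (ν x - μ x) ^ 2) / m) := by
  obtain ⟨c, hc, h⟩ := exists_mul_sum_sq_le_action hQ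
  refine ⟨4 / c, by positivity, fun μ hμ ν hν hμ0 hν0 m hm hlow => ?_⟩
  rcases isEmpty_or_nonempty X with hX | hX
  · rw [Subsingleton.elim μ ν, transportDist_self hν]
    exact zero_le
  set R := ∑ x, (ν x - μ x) ^ 2 with hR
  have hR0 : 0 ≤ R := Finset.sum_nonneg fun _ _ => sq_nonneg _
  obtain ⟨z, hz⟩ := Finite.exists_min fun x => min (μ x) (ν x)
  -- This bound depends on both endpoints; it serves only to make the curve positive and the
  -- potential bounded, and does not enter the estimate of the distance.
  set m₀ := min (μ z) (ν z) with hm₀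
  have hm₀0 : 0 < m₀ := lt_min (hμ0 z) (hν0 z)
  set η : ℝ → X → ℝ := fun t x => μ x + t ^ 2 * (ν x - μ x) with hη
  set σ : ℝ → X → ℝ := fun t x => 2 * t * (ν x - μ x) with hσ
  have hsub : ∑ x, (ν x - μ x) = 0 := by rw [Finset.sum_sub_distrib, hμ.2, hν.2, sub_self]
  have hlow0 : ∀ t ∈ Set.Icc (0 : ℝ) 1, ∀ x, m₀ ≤ η t x := by
    intro t ht x
    have h1 : m₀ ≤ μ x := (hz x).trans (min_le_left _ _)
    have h2 : m₀ ≤ ν x := (hz x).trans (min_le_right _ _)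
    have h3 : t ^ 2 ≤ 1 := pow_le_one₀ ht.1 ht.2
    have h4 : 0 ≤ t ^ 2 := sq_nonneg t
    simp only [hη]
    nlinarith
  have hmem : ∀ t ∈ Set.Icc (0 : ℝ) 1, η t ∈ stdSimplex ℝ X := fun t ht => by
    refine ⟨fun x => hm₀0.le.trans (hlow0 t ht x), ?_⟩
    simp only [hη]
    rw [Finset.sum_add_distrib, ← Finset.mul_sum, hsub, hμ.2, mul_zero, add_zero]
  obtain ⟨ψ, hce, hE⟩ := exists_continuityEquation hQ (η := η) (σ := σ)
    (E := 4 / c * R / m) (C := (4 / c * R / m) / (c * m₀)) hmem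
    (fun t ht x => hm₀0.trans_le (hlow0 t (Set.Ioc_subset_Icc_self ht) x))
    (fun t x => by
      simpa [hη, hσ] using ((hasDerivAt_pow 2 t).mul_const (ν x - μ x)).const_add (μ x))
    (by fun_prop)
    (fun t => by
      simp only [hσ]
      rw [← Finset.mul_sum, hsub, mul_zero])
    (fun t ht ψ hψ hψσ => by
      have ht' := Set.Ioc_subset_Icc_self ht
      have h1 := h (η t) (hmem t ht') (t ^ 2 * m) (by positivity) (hlow t ht') ψ hψ
      have h2 := h (η t) (hmem t ht') m₀ hm₀0.le (hlow0 t ht') ψ hψ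
      have hA0 := hQ.action_nonneg (hmem t ht') ψ
      have hA : action Q (η t) ψ = 2 * t * ∑ x, ψ x * (ν x - μ x) := by
        rw [action_eq_sum_mul_onsager, Finset.mul_sum]
        refine Finset.sum_congr rfl fun x _ => ?_
        rw [hψσ x]
        ring
      have hcs : (∑ x, ψ x * (ν x - μ x)) ^ 2 ≤ (∑ x, ψ x ^ 2) * R :=
        Finset.sum_mul_sq_le_sq_mul_sq _ _ _
      set A := action Q (η t) ψ with hAdef
      set P := ∑ x, ψ x ^ 2 with hP
      have hA2 : A ^ 2 ≤ 4 * t ^ 2 * (P * R) := by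
        rw [hA, mul_pow]
        nlinarith [sq_nonneg t]
      have ht2 : 0 < t ^ 2 := pow_pos ht.1 2
      -- From `A² ≤ 4t² P R` and the coercivity `c t² m P ≤ A`; the powers of `t` cancel.
      have hbound : A ≤ 4 / c * R / m := by
        rw [le_div_iff₀ hm, div_mul_eq_mul_div, le_div_iff₀ hc]
        rcases hA0.eq_or_lt with h0 | h0
        · rw [← h0]
          nlinarith
        · have h3 : A * (t ^ 2 * (A * m * c)) ≤ A * (t ^ 2 * (4 * R)) := by
            have h4 : c * m * A ^ 2 ≤ c * m * (4 * t ^ 2 * (P * R)) := by gcongr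
            have h5 : 4 * R * (c * (t ^ 2 * m) * P) ≤ 4 * R * A := by gcongr
            nlinarith
          exact le_of_mul_le_mul_left (le_of_mul_le_mul_left h3 h0) ht2
      refine ⟨hbound, ?_⟩
      rw [le_div_iff₀ (by positivity)]
      linarith)
  have := transportDist_le hce hE
  have e0 : η 0 = μ := by ext x; simp [hη]
  have e1 : η 1 = ν := by ext x; simp [hη]
  rwa [e0, e1] at this

/-- The transport distance is uniformly continuous on the measures of full support. -/
theorem exists_transportDist_le_of_pos [Nonempty X] (hQ : IsNonlinearMarkovTriple K Q)
    {ε : ℝ} (hε : 0 < ε) :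
    ∃ r : ℝ, 0 < r ∧ ∀ μ ∈ stdSimplex ℝ X, ∀ ν ∈ stdSimplex ℝ X, (∀ x, 0 < μ x) → (∀ x, 0 < ν x) →
      dist ν μ < r → transportDist Q μ ν ≤ ENNReal.ofReal ε := by
  obtain ⟨C, hC, h⟩ := exists_transportDist_le_of_segment hQ
  set N : ℝ := (Fintype.card X : ℝ) with hN
  have hN0 : 0 < N := by rw [hN]; exact_mod_cast Fintype.card_pos
  -- Both measures are first pulled towards the uniform one by a fraction `δ`, which puts mass at
  -- least `δ/N` everywhere. This costs `C (N δ²)/(δ/N) = C δ N²`, small whatever the measure.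
  set δ : ℝ := min (1 / 2) ((ε / 3) ^ 2 / (C * N ^ 2)) with hδ
  have hδ0 : 0 < δ := by positivity
  have hδ1 : δ < 1 := (min_le_left _ _).trans_lt (by norm_num)
  have hδ2 : C * δ * N ^ 2 ≤ (ε / 3) ^ 2 := by
    have : δ ≤ (ε / 3) ^ 2 / (C * N ^ 2) := min_le_right _ _
    rw [le_div_iff₀ (by positivity)] at this
    linarith
  set u : ℝ := 1 / N with hu
  have hu0 : 0 < u := by positivity
  have hu1 : u ≤ 1 := by
    rw [hu, div_le_one hN0, hN]
    exact_mod_cast Fintype.card_pos (α := X)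
  have hNu : N * u = 1 := by rw [hu]; field_simp
  set b : (X → ℝ) → X → ℝ := fun μ x => μ x + δ * (u - μ x) with hb
  have hbl : ∀ μ ∈ stdSimplex ℝ X, ∀ x, δ * u ≤ b μ x := fun μ hμ x => by
    have := hμ.1 x
    simp only [hb]
    nlinarith
  have hbs : ∀ μ ∈ stdSimplex ℝ X, b μ ∈ stdSimplex ℝ X := fun μ hμ => by
    refine ⟨fun x => le_trans (by positivity) (hbl μ hμ x), ?_⟩
    simp only [hb]
    rw [Finset.sum_add_distrib, ← Finset.mul_sum, Finset.sum_sub_distrib, hμ.2, Finset.sum_const,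
      nsmul_eq_mul, Finset.card_univ, ← hN, hNu]
    ring
  have hbp : ∀ μ ∈ stdSimplex ℝ X, ∀ x, 0 < b μ x := fun μ hμ x =>
    lt_of_lt_of_le (by positivity) (hbl μ hμ x)
  have hnear : ∀ μ ∈ stdSimplex ℝ X, (∀ x, 0 < μ x) →
      transportDist Q μ (b μ) ≤ ENNReal.ofReal (ε / 3) := by
    intro μ hμ hμ0
    refine (h μ hμ _ (hbs μ hμ) hμ0 (hbp μ hμ) (δ * u) (by positivity) ?_).trans
      (ENNReal.ofReal_le_ofReal ?_)
    · intro t ht x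
      have h3 : t ^ 2 ≤ 1 := pow_le_one₀ ht.1 ht.2
      have h4 : t ^ 2 * δ ≤ 1 := by nlinarith
      have h5 := mul_nonneg (sub_nonneg.2 h4) (hμ0 x).le
      simp only [hb]
      linarith
    · refine Real.sqrt_le_iff.2 ⟨by positivity, ?_⟩
      have hs : ∑ x, (b μ x - μ x) ^ 2 ≤ N * δ ^ 2 := by
        have : ∀ x ∈ Finset.univ, (b μ x - μ x) ^ 2 ≤ δ ^ 2 := fun x _ => by
          have h1 : μ x ≤ 1 := hμ.2 ▸ Finset.single_le_sum (f := μ) (fun i _ => hμ.1 i)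
            (Finset.mem_univ x)
          have h2 : b μ x - μ x = δ * (u - μ x) := by simp [hb]
          rw [h2, mul_pow]
          have h3 : (u - μ x) ^ 2 ≤ 1 := by
            rw [sq_le_one_iff_abs_le_one, abs_le]
            constructor <;> linarith [hμ0 x]
          nlinarith [sq_nonneg δ]
        simpa [hN] using Finset.sum_le_sum this
      calc C * (∑ x, (b μ x - μ x) ^ 2) / (δ * u) ≤ C * (N * δ ^ 2) / (δ * u) := by gcongr
        _ = C * δ * N ^ 2 := by rw [hu]; field_simp
        _ ≤ _ := hδ2
  -- The radius solves `C N r² / (δ u) = (ε/3)²`, the cost of the middle segment, whose masses are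
  -- at least `δ u`.
  refine ⟨√(δ * u * (ε / 3) ^ 2 / (C * N)), by positivity, fun μ hμ ν hν hμ0 hν0 hdist => ?_⟩
  have hmid : transportDist Q (b μ) (b ν) ≤ ENNReal.ofReal (ε / 3) := by
    refine (h _ (hbs μ hμ) _ (hbs ν hν) (hbp μ hμ) (hbp ν hν) (δ * u) (by positivity) ?_).trans
      (ENNReal.ofReal_le_ofReal ?_)
    · intro t ht x
      have h1 := hbl μ hμ x
      have h2 := hbl ν hν x
      have h3 : t ^ 2 ≤ 1 := pow_le_one₀ ht.1 ht.2
      have h4 : 0 ≤ t ^ 2 := sq_nonneg t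
      have h5 : 0 < δ * u := by positivity
      nlinarith
    · refine Real.sqrt_le_iff.2 ⟨by positivity, ?_⟩
      have hd2 : dist ν μ ^ 2 ≤ δ * u * (ε / 3) ^ 2 / (C * N) := by
        rw [← Real.sq_sqrt (x := δ * u * (ε / 3) ^ 2 / (C * N)) (by positivity)]
        exact pow_le_pow_left₀ dist_nonneg hdist.le 2
      have hs : ∑ x, (b ν x - b μ x) ^ 2 ≤ N * dist ν μ ^ 2 := by
        have : ∀ x ∈ Finset.univ, (b ν x - b μ x) ^ 2 ≤ dist ν μ ^ 2 := fun x _ => by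
          have h1 : |ν x - μ x| ≤ dist ν μ := by
            rw [← Real.dist_eq]
            exact dist_le_pi_dist ν μ x
          have h2 : b ν x - b μ x = (1 - δ) * (ν x - μ x) := by simp only [hb]; ring
          rw [h2, mul_pow]
          have h3 : (ν x - μ x) ^ 2 ≤ dist ν μ ^ 2 := by
            rw [← sq_abs]
            exact pow_le_pow_left₀ (abs_nonneg _) h1 2
          have h4 : (1 - δ) ^ 2 ≤ 1 := pow_le_one₀ (by linarith) (by linarith)
          nlinarith [sq_nonneg (ν x - μ x)]
        simpa [hN] using Finset.sum_le_sum this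
      rw [le_div_iff₀ (by positivity)] at hd2
      rw [div_le_iff₀ (by positivity)]
      calc C * ∑ x, (b ν x - b μ x) ^ 2 ≤ C * (N * dist ν μ ^ 2) := by gcongr
        _ ≤ _ := by linarith
  calc transportDist Q μ ν ≤ transportDist Q μ (b μ) + transportDist Q (b μ) ν :=
        transportDist_triangle hQ _ _ _
    _ ≤ transportDist Q μ (b μ) + (transportDist Q (b μ) (b ν) + transportDist Q (b ν) ν) := by
        gcongr
        exact transportDist_triangle hQ _ _ _
    _ ≤ ENNReal.ofReal (ε / 3) + (ENNReal.ofReal (ε / 3) + ENNReal.ofReal (ε / 3)) := by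
        gcongr
        · exact hnear μ hμ hμ0
        · rw [transportDist_comm hQ]
          exact hnear ν hν hν0
    _ = ENNReal.ofReal ε := by
        rw [← ENNReal.ofReal_add (by positivity) (by positivity),
          ← ENNReal.ofReal_add (by positivity) (by positivity)]
        congr 1
        ring

end

/-! ### Leaving the boundary of the simplex along a tree -/

section

/-- Exponents along a tree rooted at `a`, given by the function `p` sending a vertex to its parent:
they increase along the branches, but in a strongly concave way. -/
theorem exists_tree_exponents {X : Type*} [Finite X] {r : X → X → Prop} (a : X)
    (h : ∀ x, Relation.ReflTransGen r a x) :
    ∃ (k : X → ℕ) (p : X → X) (B : ℕ), k a = 0 ∧ (∀ x, k x ≤ B) ∧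
      ∀ x, x ≠ a → r (p x) x ∧ k (p x) + 1 + 2 * B ≤ 3 * k x := by
  classical
  -- `R n x` says that `x` is reached from `a` in `n` steps; the least such `n` is the depth, and a
  -- parent is a predecessor of smaller depth.
  let R : ℕ → X → Prop := fun n => Nat.rec (motive := fun _ => X → Prop) (fun x => x = a)
    (fun _ P x => ∃ y, P y ∧ r y x) n
  have hR : ∀ x, ∃ n, R n x := fun x => by
    induction h x with
    | refl => exact ⟨0, rfl⟩
    | tail _ hbc ih => exact ⟨ih.choose + 1, _, ih.choose_spec, hbc⟩
  let d : X → ℕ := fun x => Nat.find (p := fun n => R n x) (hR x)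
  have hd0 : d a = 0 := (Nat.find_eq_zero _).2 rfl
  have hpar : ∀ x, ∃ y, x ≠ a → r y x ∧ d y < d x := fun x => by
    by_cases hx : x = a
    · exact ⟨x, fun h => absurd hx h⟩
    have hs : R (d x) x := Nat.find_spec (hR x)
    rcases hn : d x with _ | n
    · rw [hn] at hs
      exact absurd hs hx
    · rw [hn] at hs
      obtain ⟨y, hy, hyx⟩ := hs
      exact ⟨y, fun _ => ⟨hyx, Nat.lt_succ_of_le (Nat.find_le hy)⟩⟩
  choose p hp using hpar
  obtain ⟨D, hD⟩ := (Set.finite_range d).bddAbove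
  have hD' : ∀ x, d x ≤ D := fun x => hD ⟨x, rfl⟩
  -- With `q = 4^(D - d x)`, the gap `B - k` is `q` at `x` and at least `4q` at its parent; the
  -- claim reduces to `4q ≥ 3q + 1`.
  refine ⟨fun x => 4 ^ D - 4 ^ (D - d x), p, 4 ^ D, by simp [hd0], fun x => Nat.sub_le _ _,
    fun x hx => ⟨(hp x hx).1, ?_⟩⟩
  have h1 := (hp x hx).2
  have h2 : 4 * 4 ^ (D - d x) ≤ 4 ^ (D - d (p x)) := by
    rw [← pow_succ']
    exact Nat.pow_le_pow_right (by norm_num) (by have := hD' x; omega)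
  have h3 : 4 ^ (D - d (p x)) ≤ 4 ^ D := Nat.pow_le_pow_right (by norm_num) (by omega)
  have h4 : 1 ≤ 4 ^ (D - d x) := Nat.one_le_pow _ _ (by norm_num)
  simp only
  omega

variable {X : Type*} [Fintype X] [DecidableEq X] {K : X → (X → ℝ) → ℝ}
  {Q : (X → ℝ) → Matrix X X ℝ}

/-- Every measure is a limit, for the transport distance, of measures with full support. -/
theorem exists_pos_transportDist_le (hQ : IsNonlinearMarkovTriple K Q) {μ : X → ℝ}
    (hμ : μ ∈ stdSimplex ℝ X) {ε : ℝ} (hε : 0 < ε) :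
    ∃ ν ∈ stdSimplex ℝ X, (∀ x, 0 < ν x) ∧ dist ν μ < ε ∧
      transportDist Q μ ν ≤ ENNReal.ofReal ε := by
  obtain ⟨a, ha⟩ : ∃ a, 0 < μ a := by
    by_contra! hc
    have := Finset.sum_nonpos fun a (_ : a ∈ Finset.univ) => hc a
    linarith [hμ.2]
  have hX : Nonempty X := ⟨a⟩
  obtain ⟨k, p, B, hka, hkB, hp⟩ := exists_tree_exponents a (hQ.irreducible μ hμ a)
  obtain ⟨c, hc, hcoer⟩ := exists_mul_sum_sq_le_action hQ
  have hk1 : ∀ x, x ≠ a → k (p x) + 1 ≤ k x := fun x hx => by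
    have := (hp x hx).2
    have := hkB x
    have := hkB (p x)
    omega
  have hpne : ∀ x, x ≠ a → p x ≠ x := fun x hx he => by
    have := hk1 x hx
    rw [he] at this
    omega
  -- the conductances of the tree edges stay positive near `μ`
  obtain ⟨g, hg, ρ, hρ, hcond⟩ : ∃ g : ℝ, 0 < g ∧ ∃ ρ : ℝ, 0 < ρ ∧ ∀ ν ∈ stdSimplex ℝ X,
      dist ν μ < ρ → ∀ x, x ≠ a → g ≤ √(Q ν (p x) x * Q ν x (p x)) := by
    set G : X → (X → ℝ) → ℝ := fun x ν => √(Q ν (p x) x * Q ν x (p x)) with hG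
    have hGpos : ∀ x, x ≠ a → 0 < G x μ := fun x hx =>
      Real.sqrt_pos.2 (mul_pos (hp x hx).1 (hQ.rate_pos_symm hμ (hp x hx).1))
    obtain ⟨z, hz⟩ := Finite.exists_min fun x => if x = a then 1 else G x μ
    set g₀ := if z = a then 1 else G z μ with hg₀
    have hg₀0 : 0 < g₀ := by
      rw [hg₀]
      split_ifs with hza
      · exact one_pos
      · exact hGpos z hza
    have hev : ∀ᶠ ν in 𝓝[stdSimplex ℝ X] μ, ∀ x, x ≠ a → g₀ / 2 ≤ G x ν := by
      refine eventually_all.2 fun x => ?_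
      by_cases hx : x = a
      · exact Eventually.of_forall fun ν h => absurd hx h
      · have hcx : ContinuousOn (G x) (stdSimplex ℝ X) := Real.continuous_sqrt.comp_continuousOn
          ((hQ.continuousOn_rate (p x) x).mul (hQ.continuousOn_rate x (p x)))
        have hlt : g₀ / 2 < G x μ := by
          have := hz x
          simp only [hx, if_false] at this
          linarith
        filter_upwards [(hcx μ hμ).eventually_const_lt hlt] with ν hν _ using hν.le
    obtain ⟨ρ, hρ, hball⟩ := Metric.mem_nhdsWithin_iff.1 hev
    exact ⟨g₀ / 2, by positivity, ρ, hρ, fun ν hν hd => hball ⟨hd, hν⟩⟩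
  set N : ℝ := (Fintype.card X : ℝ) with hN
  have hN0 : 0 < N := by rw [hN]; exact_mod_cast Fintype.card_pos
  have hN1 : 1 ≤ N := by rw [hN]; exact_mod_cast Fintype.card_pos (α := X)
  set κ : ℝ := μ a / 2 with hκ
  have hκ0 : 0 < κ := by positivity
  have hκ1 : κ ≤ 1 / 2 := by
    have h1 : μ a ≤ 1 := hμ.2 ▸ Finset.single_le_sum (f := μ) (fun i _ => hμ.1 i)
      (Finset.mem_univ a)
    rw [hκ]
    linarith
  -- The total displacement `N τ` must leave the root half its mass, stay where the tree rates are
  -- bounded below, and be smaller than `ε`.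
  set τ : ℝ := min κ (min (ρ / 2) (ε / 2)) / N with hτ
  have hτ0 : 0 < τ := by positivity
  have hNτ : N * τ = min κ (min (ρ / 2) (ε / 2)) := by rw [hτ]; field_simp
  have hNκ : N * τ ≤ κ := hNτ ▸ min_le_left _ _
  have hNρ : N * τ < ρ := by
    rw [hNτ]
    exact ((min_le_right _ _).trans (min_le_left _ _)).trans_lt (by linarith)
  have hNε : N * τ < ε := by
    rw [hNτ]
    exact ((min_le_right _ _).trans (min_le_right _ _)).trans_lt (by linarith)
  have hτ1 : τ ≤ 1 := by nlinarith
  set e : X → ℝ := fun z => if z = a then 0 else 1 with he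
  have he0 : ∀ z, 0 ≤ e z := fun z => by simp only [he]; split_ifs <;> norm_num
  have he1 : ∀ z, e z ≤ 1 := fun z => by simp only [he]; split_ifs <;> norm_num
  have hea : e a = 0 := if_pos rfl
  set D : X → X → ℝ := fun z x => (if x = z then 1 else 0) - (if x = p z then 1 else 0) with hD
  have hDabs : ∀ z x, |D z x| ≤ 1 := fun z x => by
    simp only [hD]
    split_ifs <;> norm_num
  have hDsum : ∀ z, ∑ x, D z x = 0 := fun z => by
    simp [hD, Finset.sum_sub_distrib]
  -- With `s = τ t`, the amount `s^(4 k z)` has moved from the parent `p z` to `z` by time `t`; `e`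
  -- suppresses the missing edge above the root. A vertex hands on to each child at most `τ` times
  -- what it has received, so its mass is at least `κ s^(4 k)`.
  set η : ℝ → X → ℝ := fun t x => μ x + ∑ z, e z * (τ * t) ^ (4 * k z) * D z x with hη
  set σ : ℝ → X → ℝ := fun t x =>
    ∑ z, e z * ((4 * k z : ℕ) * (τ * t) ^ (4 * k z - 1) * τ) * D z x with hσ
  have hs0 : ∀ t ∈ Set.Icc (0 : ℝ) 1, 0 ≤ τ * t := fun t ht => mul_nonneg hτ0.le ht.1
  have hsτ : ∀ t ∈ Set.Icc (0 : ℝ) 1, τ * t ≤ τ := fun t ht => by nlinarith [ht.2]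
  have hterm : ∀ t ∈ Set.Icc (0 : ℝ) 1, ∀ z,
      e z * (τ * t) ^ (4 * k z) ≤ τ * (τ * t) ^ (4 * k (p z)) := by
    intro t ht z
    by_cases hz : z = a
    · rw [hz, hea, zero_mul]
      have := hs0 t ht
      positivity
    · have h1 : (τ * t) ^ (4 * k z) ≤ (τ * t) ^ (4 * k (p z) + 1) :=
        pow_le_pow_of_le_one (hs0 t ht) ((hsτ t ht).trans hτ1) (by have := hk1 z hz; omega)
      have h2 : (τ * t) ^ (4 * k (p z) + 1) ≤ τ * (τ * t) ^ (4 * k (p z)) := by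
        rw [pow_succ, mul_comm]
        exact mul_le_mul_of_nonneg_right (hsτ t ht) (pow_nonneg (hs0 t ht) _)
      have h3 : e z = 1 := if_neg hz
      rw [h3, one_mul]
      exact h1.trans h2
  have hlow : ∀ t ∈ Set.Icc (0 : ℝ) 1, ∀ x, κ * (τ * t) ^ (4 * k x) ≤ η t x := by
    intro t ht x
    set s := τ * t with hs
    have hsx : 0 ≤ s ^ (4 * k x) := pow_nonneg (hs0 t ht) _
    have h1 : ∑ z, e z * s ^ (4 * k z) * D z x =
        e x * s ^ (4 * k x) - ∑ z, e z * s ^ (4 * k z) * (if x = p z then 1 else 0) := by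
      simp only [hD, mul_sub, Finset.sum_sub_distrib]
      simp
    have h2 : ∑ z, e z * s ^ (4 * k z) * (if x = p z then 1 else 0) ≤
        ∑ _z : X, τ * s ^ (4 * k x) := by
      refine Finset.sum_le_sum fun z _ => ?_
      split_ifs with hz
      · rw [mul_one, hz]
        exact hterm t ht z
      · rw [mul_zero]
        positivity
    rw [Finset.sum_const, nsmul_eq_mul, Finset.card_univ, ← hN, ← mul_assoc] at h2
    have h3 : N * τ * s ^ (4 * k x) ≤ κ * s ^ (4 * k x) := by gcongr
    simp only [hη]
    rw [h1]
    by_cases hx : x = a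
    · rw [hx, hea, hka]
      rw [hx, hka] at h2 h3
      simp only [mul_zero, pow_zero, mul_one] at h2 h3 ⊢
      linarith
    · have h4 : e x = 1 := if_neg hx
      rw [h4]
      have h5 : κ * s ^ (4 * k x) ≤ 1 / 2 * s ^ (4 * k x) := by gcongr
      linarith [hμ.1 x]
  have hmem : ∀ t ∈ Set.Icc (0 : ℝ) 1, η t ∈ stdSimplex ℝ X := by
    refine fun t ht => ⟨fun x => le_trans ?_ (hlow t ht x), ?_⟩
    · have := hs0 t ht
      positivity
    · simp only [hη]
      rw [Finset.sum_add_distrib, hμ.2, Finset.sum_comm]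
      simp [← Finset.mul_sum, hDsum]
  have hposη : ∀ t ∈ Set.Ioc (0 : ℝ) 1, ∀ x, 0 < η t x := by
    refine fun t ht x => lt_of_lt_of_le ?_ (hlow t (Set.Ioc_subset_Icc_self ht) x)
    have := mul_pos hτ0 ht.1
    positivity
  have hdist : ∀ t ∈ Set.Icc (0 : ℝ) 1, dist (η t) μ ≤ N * τ := by
    intro t ht
    refine (dist_pi_le_iff (by positivity)).2 fun x => ?_
    have h1 : η t x - μ x = ∑ z, e z * (τ * t) ^ (4 * k z) * D z x := by simp [hη]
    rw [Real.dist_eq, h1]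
    refine (Finset.abs_sum_le_sum_abs _ _).trans ?_
    have h2 : ∀ z ∈ Finset.univ, |e z * (τ * t) ^ (4 * k z) * D z x| ≤ τ := by
      intro z _
      have h3 : 0 ≤ e z * (τ * t) ^ (4 * k z) := mul_nonneg (he0 z) (pow_nonneg (hs0 t ht) _)
      rw [abs_mul, abs_of_nonneg h3]
      calc e z * (τ * t) ^ (4 * k z) * |D z x| ≤ e z * (τ * t) ^ (4 * k z) * 1 := by
            gcongr
            exact hDabs z x
        _ ≤ τ * (τ * t) ^ (4 * k (p z)) := by rw [mul_one]; exact hterm t ht z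
        _ ≤ τ * 1 := by
            gcongr
            exact pow_le_one₀ (hs0 t ht) ((hsτ t ht).trans hτ1)
        _ = τ := mul_one τ
    simpa [hN] using Finset.sum_le_sum h2
  have hzero : η 0 = μ := by
    ext x
    simp only [hη, mul_zero]
    rw [Finset.sum_eq_zero fun z _ => ?_, add_zero]
    by_cases hz : z = a
    · rw [hz, hea]
      simp
    · have h1 := hk1 z hz
      rw [zero_pow (by omega)]
      simp
  set C₁ : ℝ := (4 * B) ^ 2 / (κ * g) with hC₁
  set C₂ : ℝ := N ^ 2 * C₁ with hC₂
  have hC₂0 : 0 ≤ C₂ := by positivity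
  obtain ⟨ψ, hce, hE⟩ := exists_continuityEquation hQ (η := η) (σ := σ) (E := C₂)
    (C := C₂ / (c * κ)) hmem hposη
    (fun t x => by
      simp only [hη, hσ]
      refine HasDerivAt.const_add _ (HasDerivAt.fun_sum fun z _ =>
        HasDerivAt.mul_const (HasDerivAt.const_mul _ ?_) _)
      have h1 : HasDerivAt (fun t : ℝ => τ * t) τ t := by
        simpa using (hasDerivAt_id t).const_mul τ
      exact h1.fun_pow (4 * k z))
    (by fun_prop)
    (fun t => by
      simp only [hσ]
      rw [Finset.sum_comm]
      simp [← Finset.mul_sum, hDsum])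
    (fun t ht ψ hψ hψσ => by
      have ht' := Set.Ioc_subset_Icc_self ht
      set s := τ * t with hs
      have hsp : 0 < s := mul_pos hτ0 ht.1
      have hs1 : s ≤ 1 := (hsτ t ht').trans hτ1
      have hA0 := hQ.action_nonneg (hmem t ht') ψ
      set A := action Q (η t) ψ with hAdef
      set b : X → ℝ := fun z => e z * ((4 * k z : ℕ) * s ^ (4 * k z - 1) * τ) with hb
      have hA : A = ∑ z, b z * (ψ z - ψ (p z)) := by
        rw [hAdef, action_eq_sum_mul_onsager]
        simp only [hψσ, hσ, Finset.mul_sum]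
        rw [Finset.sum_comm]
        refine Finset.sum_congr rfl fun z _ => ?_
        have h1 : ∑ x, ψ x * D z x = ψ z - ψ (p z) := by
          simp [hD, mul_sub, Finset.sum_sub_distrib]
        rw [← h1, Finset.mul_sum]
        exact Finset.sum_congr rfl fun x _ => by simp only [hb]; ring
      -- The flux through the edge is of order `s^(4 k z - 1)` and its weight at least of order
      -- `s^(2 k(p z) + 2 k z)`. The condition on the exponents says precisely that flux² / weight
      -- is of order at most `s^(4B)`.
      have hedge : ∀ z ∈ Finset.univ, (b z * (ψ z - ψ (p z))) ^ 2 ≤ C₁ * s ^ (4 * B) * A := by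
        intro z _
        by_cases hz : z = a
        · have : b z = 0 := by simp only [hb, hz, hea, zero_mul]
          rw [this]
          have : 0 ≤ C₁ * s ^ (4 * B) * A := by positivity
          simpa using this
        have h1 := hQ.sq_mul_edgeWeight_le_action (hmem t ht') ψ (hpne z hz)
        have h2 := hQ.sqrt_mul_sqrt_le_edgeWeight (hmem t ht') (hpne z hz)
        have h3 := hcond (η t) (hmem t ht') ((hdist t ht').trans_lt hNρ) z hz
        have h4 : κ * s ^ (2 * k (p z) + 2 * k z) ≤ √(η t (p z) * η t z) := by
          refine Real.le_sqrt_of_sq_le ?_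
          calc (κ * s ^ (2 * k (p z) + 2 * k z)) ^ 2 =
                (κ * s ^ (4 * k (p z))) * (κ * s ^ (4 * k z)) := by ring
            _ ≤ η t (p z) * η t z :=
                mul_le_mul (hlow t ht' _) (hlow t ht' _) (by positivity) ((hmem t ht').1 _)
        have h5 : κ * s ^ (2 * k (p z) + 2 * k z) * g ≤ edgeWeight Q (η t) (p z) z :=
          (mul_le_mul h4 h3 hg.le (Real.sqrt_nonneg _)).trans h2
        have h6 : (ψ z - ψ (p z)) ^ 2 * (κ * s ^ (2 * k (p z) + 2 * k z) * g) ≤ A :=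
          (mul_le_mul_of_nonneg_left h5 (sq_nonneg _)).trans h1
        have h7 : b z ^ 2 ≤ (4 * B) ^ 2 * (s ^ (4 * B) * s ^ (2 * k (p z) + 2 * k z)) := by
          have hkz := hp z hz |>.2
          have h8 : s ^ (2 * (4 * k z - 1)) ≤ s ^ (4 * B + (2 * k (p z) + 2 * k z)) :=
            pow_le_pow_of_le_one hsp.le hs1 (by omega)
          have h9 : b z ≤ 4 * B * s ^ (4 * k z - 1) := by
            have hkb : ((4 * k z : ℕ) : ℝ) ≤ 4 * B := by exact_mod_cast Nat.mul_le_mul_left 4 (hkB z)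
            calc b z ≤ 1 * (4 * B * s ^ (4 * k z - 1) * 1) := by
                  simp only [hb]
                  gcongr
                  exact he1 z
              _ = _ := by ring
          have h10 : 0 ≤ b z := by
            have := he0 z
            simp only [hb]
            positivity
          calc b z ^ 2 ≤ (4 * B * s ^ (4 * k z - 1)) ^ 2 := pow_le_pow_left₀ h10 h9 2
            _ = (4 * B) ^ 2 * s ^ (2 * (4 * k z - 1)) := by rw [mul_pow, ← pow_mul, mul_comm 2]
            _ ≤ _ := by
              rw [← pow_add]
              gcongr
        rw [mul_pow, hC₁, div_mul_eq_mul_div, div_mul_eq_mul_div, le_div_iff₀ (by positivity)]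
        calc b z ^ 2 * (ψ z - ψ (p z)) ^ 2 * (κ * g) ≤
              ((4 * B) ^ 2 * (s ^ (4 * B) * s ^ (2 * k (p z) + 2 * k z))) *
                (ψ z - ψ (p z)) ^ 2 * (κ * g) := by gcongr
          _ = (4 * B) ^ 2 * s ^ (4 * B) *
                ((ψ z - ψ (p z)) ^ 2 * (κ * s ^ (2 * k (p z) + 2 * k z) * g)) := by ring
          _ ≤ _ := by gcongr
      have hA2 : A ^ 2 ≤ C₂ * s ^ (4 * B) * A := by
        have h1 : (∑ z, b z * (ψ z - ψ (p z))) ^ 2 ≤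
            N * ∑ z, (b z * (ψ z - ψ (p z))) ^ 2 := by
          have := sq_sum_le_card_mul_sum_sq (s := Finset.univ) (f := fun z => b z * (ψ z - ψ (p z)))
          simpa [hN] using this
        have h2 := Finset.sum_le_sum hedge
        rw [Finset.sum_const, nsmul_eq_mul, Finset.card_univ, ← hN] at h2
        rw [← hA] at h1
        calc A ^ 2 ≤ N * (N * (C₁ * s ^ (4 * B) * A)) := h1.trans (by gcongr)
          _ = C₂ * s ^ (4 * B) * A := by rw [hC₂]; ring
      have hAle : A ≤ C₂ * s ^ (4 * B) := by
        rcases hA0.eq_or_lt with h0 | h0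
        · rw [← h0]
          positivity
        · exact le_of_mul_le_mul_right (by rw [← pow_two]; exact hA2) h0
      refine ⟨hAle.trans (mul_le_of_le_one_right hC₂0 (pow_le_one₀ hsp.le hs1)), ?_⟩
      -- The decay `s^(4B)` of the action compensates the least mass `κ s^(4B)`, so `ψ` remains
      -- bounded as `t → 0`. This is why the exponents achieve more than a bounded action.
      have h1 := hcoer (η t) (hmem t ht') (κ * s ^ (4 * B)) (by positivity) (fun x => by
        refine le_trans ?_ (hlow t ht' x)
        gcongr κ * ?_
        exact pow_le_pow_of_le_one hsp.le hs1 (Nat.mul_le_mul_left 4 (hkB x))) ψ hψ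
      rw [le_div_iff₀ (by positivity)]
      have hsB : 0 < s ^ (4 * B) := pow_pos hsp _
      refine le_of_mul_le_mul_right ?_ hsB
      calc (∑ x, ψ x ^ 2) * (c * κ) * s ^ (4 * B) = c * (κ * s ^ (4 * B)) * ∑ x, ψ x ^ 2 := by ring
        _ ≤ C₂ * s ^ (4 * B) := h1.trans hAle)
  -- The distance from `μ` is at most `√(t₀ C₂)`; the `+ 1` guards against `C₂ = 0`.
  set t₀ : ℝ := min 1 (ε ^ 2 / (C₂ + 1)) with ht₀
  have ht₀0 : 0 < t₀ := by positivity
  have ht₀1 : t₀ ≤ 1 := min_le_left _ _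
  have hW := hce.transportDist_zero_le hQ hC₂0 hE ht₀0.le ht₀1
  rw [hzero] at hW
  refine ⟨η t₀, hmem t₀ ⟨ht₀0.le, ht₀1⟩, hposη t₀ ⟨ht₀0, ht₀1⟩,
    (hdist t₀ ⟨ht₀0.le, ht₀1⟩).trans_lt hNε, hW.trans (ENNReal.ofReal_le_ofReal ?_)⟩
  refine Real.sqrt_le_iff.2 ⟨hε.le, ?_⟩
  have h1 : t₀ ≤ ε ^ 2 / (C₂ + 1) := min_le_right _ _
  rw [le_div_iff₀ (by positivity)] at h1
  linarith

end

/-! ### Uniform continuity of the distance and existence of geodesics -/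

section

variable {X : Type*} [Fintype X] [DecidableEq X] {K : X → (X → ℝ) → ℝ}
  {Q : (X → ℝ) → Matrix X X ℝ}

/-- The transport distance is uniformly continuous on the simplex. -/
theorem exists_transportDist_le_of_dist_lt [Nonempty X] (hQ : IsNonlinearMarkovTriple K Q)
    {ε : ℝ} (hε : 0 < ε) :
    ∃ r : ℝ, 0 < r ∧ ∀ μ ∈ stdSimplex ℝ X, ∀ ν ∈ stdSimplex ℝ X,
      dist ν μ < r → transportDist Q μ ν ≤ ENNReal.ofReal ε := by
  have hε3 : 0 < ε / 3 := by positivity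
  obtain ⟨r, hr, h⟩ := exists_transportDist_le_of_pos hQ hε3
  refine ⟨r / 3, by positivity, fun μ hμ ν hν hd => ?_⟩
  have hm : 0 < min (r / 3) (ε / 3) := by positivity
  obtain ⟨μ', hμ', hμ0, hμd, hμW⟩ := exists_pos_transportDist_le hQ hμ hm
  obtain ⟨ν', hν', hν0, hνd, hνW⟩ := exists_pos_transportDist_le hQ hν hm
  have hd' : dist ν' μ' < r := by
    have h1 := dist_triangle4 ν' ν μ μ'
    rw [dist_comm μ μ'] at h1
    linarith [hμd.trans_le (min_le_left _ _), hνd.trans_le (min_le_left _ _)]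
  have hle : ENNReal.ofReal (min (r / 3) (ε / 3)) ≤ ENNReal.ofReal (ε / 3) :=
    ENNReal.ofReal_le_ofReal (min_le_right _ _)
  calc transportDist Q μ ν ≤ transportDist Q μ μ' + transportDist Q μ' ν :=
        transportDist_triangle hQ _ _ _
    _ ≤ transportDist Q μ μ' + (transportDist Q μ' ν' + transportDist Q ν' ν) := by
        gcongr
        exact transportDist_triangle hQ _ _ _
    _ ≤ ENNReal.ofReal (ε / 3) + (ENNReal.ofReal (ε / 3) + ENNReal.ofReal (ε / 3)) := by
        gcongr
        · exact hμW.trans hle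
        · exact h μ' hμ' ν' hν' hμ0 hν0 hd'
        · rw [transportDist_comm hQ]
          exact hνW.trans hle
    _ = ENNReal.ofReal ε := by
        rw [← ENNReal.ofReal_add (by positivity) (by positivity),
          ← ENNReal.ofReal_add (by positivity) (by positivity)]
        congr 1
        ring

/-- Both endpoints are joined to measures of full support, which a segment connects at finite cost.
-/
theorem transportDist_ne_top (hQ : IsNonlinearMarkovTriple K Q) {μ ν : X → ℝ}
    (hμ : μ ∈ stdSimplex ℝ X) (hν : ν ∈ stdSimplex ℝ X) : transportDist Q μ ν ≠ ⊤ := by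
  rcases isEmpty_or_nonempty X with hX | hX
  · rw [Subsingleton.elim μ ν, transportDist_self hν]
    simp
  obtain ⟨μ', hμ', hμ0, -, hμW⟩ := exists_pos_transportDist_le hQ hμ one_pos
  obtain ⟨ν', hν', hν0, -, hνW⟩ := exists_pos_transportDist_le hQ hν one_pos
  obtain ⟨C, -, h⟩ := exists_transportDist_le_of_segment hQ
  obtain ⟨z, hz⟩ := Finite.exists_min ν'
  have h1 := h μ' hμ' ν' hν' hμ0 hν0 (ν' z) (hν0 z) fun t ht x => by
    have h3 : t ^ 2 ≤ 1 := pow_le_one₀ ht.1 ht.2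
    nlinarith [hz x, hμ0 x, sq_nonneg t]
  rw [transportDist_comm hQ] at hνW
  have h2 : transportDist Q μ ν ≤
      transportDist Q μ μ' + (transportDist Q μ' ν' + transportDist Q ν' ν) :=
    (transportDist_triangle hQ _ _ _).trans
      (add_le_add le_rfl (transportDist_triangle hQ _ _ _))
  refine ne_top_of_le_ne_top ?_ (h2.trans (add_le_add hμW (add_le_add h1 hνW)))
  simp

theorem toReal_transportDist_triangle (hQ : IsNonlinearMarkovTriple K Q) {μ ν ρ : X → ℝ}
    (hμ : μ ∈ stdSimplex ℝ X) (hν : ν ∈ stdSimplex ℝ X) (hρ : ρ ∈ stdSimplex ℝ X) :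
    (transportDist Q μ ρ).toReal ≤
      (transportDist Q μ ν).toReal + (transportDist Q ν ρ).toReal := by
  have h1 := transportDist_ne_top hQ hμ hν
  have h2 := transportDist_ne_top hQ hν hρ
  rw [← ENNReal.toReal_add h1 h2]
  exact ENNReal.toReal_mono (ENNReal.add_ne_top.2 ⟨h1, h2⟩) (transportDist_triangle hQ _ _ _)

/-- A nearly optimal curve is nearly a geodesic. -/
theorem ContinuityEquation.toReal_transportDist_le (hQ : IsNonlinearMarkovTriple K Q)
    {η ψ : ℝ → X → ℝ} (h : ContinuityEquation Q η ψ) {ε : ℝ} (hε : 0 ≤ ε)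
    (hE : ∫⁻ t in Set.Icc (0 : ℝ) 1, ENNReal.ofReal (action Q (η t) (ψ t)) ≤
      ENNReal.ofReal ((transportDist Q (η 0) (η 1)).toReal ^ 2 + ε))
    {s t : ℝ} (hs : 0 ≤ s) (hst : s ≤ t) (ht : t ≤ 1) :
    (transportDist Q (η s) (η t)).toReal ≤
      (t - s) * (transportDist Q (η 0) (η 1)).toReal + √ε := by
  have hE' := ne_top_of_le_ne_top ENNReal.ofReal_ne_top hE
  set A : ℝ → ℝ := fun t => action Q (η t) (ψ t) with hA
  have hint := h.integrableOn_action hQ hE'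
  have hsub : ∀ a b : ℝ, 0 ≤ a → a ≤ b → b ≤ 1 →
      IntervalIntegrable A volume a b := fun a b ha hab hb => by
    rw [intervalIntegrable_iff_integrableOn_Icc_of_le hab]
    exact hint.mono_set (Set.Icc_subset_Icc ha hb)
  have hsq : ∀ a b : ℝ, 0 ≤ a → a ≤ b → b ≤ 1 →
      (transportDist Q (η a) (η b)).toReal ^ 2 ≤ (b - a) * ∫ r in a..b, A r ∧
        0 ≤ ∫ r in a..b, A r := fun a b ha hab hb => by
    have hnn : 0 ≤ ∫ r in a..b, A r := intervalIntegral.integral_nonneg hab fun r hr =>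
      hQ.action_nonneg (h.mem_simplex r ⟨ha.trans hr.1, hr.2.trans hb⟩) _
    refine ⟨?_, hnn⟩
    have h1 := ENNReal.toReal_mono ENNReal.ofReal_ne_top
      (h.transportDist_le_sqrt_integral hQ hE' ha hab hb)
    rw [ENNReal.toReal_ofReal (Real.sqrt_nonneg _)] at h1
    have h2 := pow_le_pow_left₀ ENNReal.toReal_nonneg h1 2
    rwa [Real.sq_sqrt (mul_nonneg (sub_nonneg.2 hab) hnn)] at h2
  have htot : (∫ r in (0 : ℝ)..s, A r) + (∫ r in s..t, A r) + (∫ r in t..1, A r) ≤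
      (transportDist Q (η 0) (η 1)).toReal ^ 2 + ε := by
    rw [intervalIntegral.integral_add_adjacent_intervals (hsub 0 s le_rfl hs (hst.trans ht))
      (hsub s t hs hst ht), intervalIntegral.integral_add_adjacent_intervals
      (hsub 0 t le_rfl (hs.trans hst) ht) (hsub t 1 (hs.trans hst) ht le_rfl)]
    rw [h.lintegral_action_eq hQ hE' le_rfl zero_le_one le_rfl] at hE
    exact (ENNReal.ofReal_le_ofReal_iff (by positivity)).1 hE
  obtain ⟨h1, n1⟩ := hsq 0 s le_rfl hs (hst.trans ht)
  obtain ⟨h2, n2⟩ := hsq s t hs hst ht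
  obtain ⟨h3, n3⟩ := hsq t 1 (hs.trans hst) ht le_rfl
  have m0 := h.mem_simplex 0 ⟨le_rfl, zero_le_one⟩
  have m1 := h.mem_simplex 1 ⟨zero_le_one, le_rfl⟩
  have ms := h.mem_simplex s ⟨hs, hst.trans ht⟩
  have mt := h.mem_simplex t ⟨hs.trans hst, ht⟩
  have htri := (toReal_transportDist_triangle hQ m0 ms m1).trans
    (add_le_add le_rfl (toReal_transportDist_triangle hQ ms mt m1))
  set D := (transportDist Q (η 0) (η 1)).toReal
  set w1 := (transportDist Q (η 0) (η s)).toReal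
  set w2 := (transportDist Q (η s) (η t)).toReal
  set w3 := (transportDist Q (η t) (η 1)).toReal
  have hD0 : 0 ≤ D := ENNReal.toReal_nonneg
  have hw2 : 0 ≤ w2 := ENNReal.toReal_nonneg
  -- For a piece of duration `l`, energy `e` and end-to-end distance `w`. Applied to the two outer
  -- pieces, it bounds their energy from below; with `D ≤ w1 + w2 + w3` this caps the middle energy
  -- by `2 D w2 - D² (t - s) + ε`. Inserted in `w2² ≤ (t - s) e`, this completes the square `(w2 -
  -- (t - s) D)² ≤ ε`.
  have young : ∀ w l e : ℝ, 0 ≤ l → 0 ≤ e → w ^ 2 ≤ l * e → 2 * D * w ≤ D ^ 2 * l + e := by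
    intro w l e hl he hw
    have h4 : (2 * D * w) ^ 2 ≤ (D ^ 2 * l + e) ^ 2 := by
      nlinarith [sq_nonneg (D ^ 2 * l - e), sq_nonneg D, mul_le_mul_of_nonneg_left hw (sq_nonneg D)]
    exact (abs_le_of_sq_le_sq' h4 (by positivity)).2
  have y1 := young w1 _ _ (by linarith) n1 h1
  have y3 := young w3 _ _ (by linarith) n3 h3
  have he2 : ∫ r in s..t, A r ≤ 2 * D * w2 - D ^ 2 * (t - s) + ε := by nlinarith
  have hfin : (w2 - (t - s) * D) ^ 2 ≤ ε := by
    have h5 : w2 ^ 2 ≤ (t - s) * (2 * D * w2 - D ^ 2 * (t - s) + ε) :=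
      h2.trans (mul_le_mul_of_nonneg_left he2 (by linarith))
    have h6 : (t - s) * ε ≤ 1 * ε := mul_le_mul_of_nonneg_right (by linarith) hε
    nlinarith
  have := Real.le_sqrt_of_sq_le hfin
  linarith

/-- Curves of energy at most `D² + 1/(n+1)` are geodesics up to a vanishing error. Since `W` is
Euclidean-continuous on the compact simplex, a pointwise limit along an ultrafilter inherits this in
the limit; neither equicontinuity nor compactness of the potentials is needed. -/
theorem exists_isGeodesic [Nonempty X] (hQ : IsNonlinearMarkovTriple K Q) {μ ν : X → ℝ}
    (hμ : μ ∈ stdSimplex ℝ X) (hν : ν ∈ stdSimplex ℝ X) :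
    ∃ γ : ℝ → X → ℝ, IsGeodesic Q γ ∧ γ 0 = μ ∧ γ 1 = ν := by
  set D := (transportDist Q μ ν).toReal with hD
  have hD0 : 0 ≤ D := ENNReal.toReal_nonneg
  have hDW : transportDist Q μ ν = ENNReal.ofReal D :=
    (ENNReal.ofReal_toReal (transportDist_ne_top hQ hμ hν)).symm
  have hseq : ∀ n : ℕ, ∃ η ψ, ContinuityEquation Q η ψ ∧ η 0 = μ ∧ η 1 = ν ∧
      ∫⁻ t in Set.Icc (0 : ℝ) 1, ENNReal.ofReal (action Q (η t) (ψ t)) ≤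
        ENNReal.ofReal (D ^ 2 + 1 / ((n : ℝ) + 1)) := fun n => by
    have hn : 0 < 1 / ((n : ℝ) + 1) := by positivity
    have hlt : transportDist Q μ ν < ENNReal.ofReal √(D ^ 2 + 1 / ((n : ℝ) + 1)) := by
      rw [hDW]
      refine (ENNReal.ofReal_lt_ofReal_iff (by positivity)).2 (Real.lt_sqrt_of_sq_lt ?_)
      linarith
    have := exists_of_transportDist_lt hlt
    rwa [Real.sq_sqrt (by positivity)] at this
  choose η ψ hce h0 h1 hE using hseq
  have hclose : ∀ n : ℕ, ∀ s t : ℝ, 0 ≤ s → s ≤ t → t ≤ 1 →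
      (transportDist Q (η n s) (η n t)).toReal ≤ (t - s) * D + √(1 / ((n : ℝ) + 1)) := by
    intro n s t hs hst ht
    have := (hce n).toReal_transportDist_le hQ (ε := 1 / ((n : ℝ) + 1)) (by positivity)
      (by rw [h0 n, h1 n]; exact hE n) hs hst ht
    rwa [h0 n, h1 n] at this
  have hlim : ∀ t : ℝ, ∃ x, t ∈ Set.Icc (0 : ℝ) 1 → x ∈ stdSimplex ℝ X ∧
      Tendsto (fun n => η n t) (hyperfilter ℕ) (𝓝 x) := fun t => by
    by_cases ht : t ∈ Set.Icc (0 : ℝ) 1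
    · obtain ⟨x, hx, hle⟩ := (isCompact_stdSimplex ℝ X).ultrafilter_le_nhds
        ((hyperfilter ℕ).map fun n => η n t) (by
          rw [Filter.le_principal_iff]
          exact Filter.mem_map.2 (Filter.univ_mem' fun n => (hce n).mem_simplex t ht))
      exact ⟨x, fun _ => ⟨hx, hle⟩⟩
    · exact ⟨0, fun h => absurd h ht⟩
  choose γ hγ using hlim
  have hmem : ∀ t ∈ Set.Icc (0 : ℝ) 1, γ t ∈ stdSimplex ℝ X := fun t ht => (hγ t ht).1
  have hI0 : (0 : ℝ) ∈ Set.Icc (0 : ℝ) 1 := ⟨le_rfl, zero_le_one⟩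
  have hI1 : (1 : ℝ) ∈ Set.Icc (0 : ℝ) 1 := ⟨zero_le_one, le_rfl⟩
  have hγ0 : γ 0 = μ := by
    refine tendsto_nhds_unique (hγ 0 hI0).2 ?_
    simp only [h0]
    exact tendsto_const_nhds
  have hγ1 : γ 1 = ν := by
    refine tendsto_nhds_unique (hγ 1 hI1).2 ?_
    simp only [h1]
    exact tendsto_const_nhds
  have hroot : Tendsto (fun n : ℕ => √(1 / ((n : ℝ) + 1))) (hyperfilter ℕ) (𝓝 0) := by
    have := (Real.continuous_sqrt.tendsto 0).comp tendsto_one_div_add_atTop_nhds_zero_nat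
    rw [Real.sqrt_zero] at this
    exact this.mono_left Nat.hyperfilter_le_atTop
  have hle : ∀ s ∈ Set.Icc (0 : ℝ) 1, ∀ t ∈ Set.Icc (0 : ℝ) 1, s ≤ t →
      (transportDist Q (γ s) (γ t)).toReal ≤ (t - s) * D := by
    intro s hs t ht hst
    refine le_of_forall_pos_le_add fun ε hε => ?_
    have hε3 : 0 < ε / 3 := by positivity
    obtain ⟨r, hr, hmod⟩ := exists_transportDist_le_of_dist_lt hQ hε3
    have e1 := (hγ s hs).2.eventually (Metric.ball_mem_nhds _ hr)
    have e2 := (hγ t ht).2.eventually (Metric.ball_mem_nhds _ hr)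
    have e3 := hroot.eventually_lt_const hε3
    obtain ⟨n, ⟨n1, n2⟩, n3⟩ := ((e1.and e2).and e3).exists
    have ms := (hce n).mem_simplex s hs
    have mt := (hce n).mem_simplex t ht
    have k1 := ENNReal.toReal_mono ENNReal.ofReal_ne_top (hmod _ (hmem s hs) _ ms n1)
    have k2 := ENNReal.toReal_mono ENNReal.ofReal_ne_top (hmod _ (hmem t ht) _ mt n2)
    rw [ENNReal.toReal_ofReal hε3.le] at k1 k2
    rw [transportDist_comm hQ] at k2
    have k3 := hclose n s t hs.1 hst ht.2
    have k4 := toReal_transportDist_triangle hQ (hmem s hs) ms (hmem t ht)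
    have k5 := toReal_transportDist_triangle hQ ms mt (hmem t ht)
    linarith
  have heq : ∀ s ∈ Set.Icc (0 : ℝ) 1, ∀ t ∈ Set.Icc (0 : ℝ) 1, s ≤ t →
      (transportDist Q (γ s) (γ t)).toReal = (t - s) * D := by
    intro s hs t ht hst
    -- The upper bounds for the three pieces add up to `D`, so by the triangle inequality none of
    -- them can be strict.
    refine le_antisymm (hle s hs t ht hst) ?_
    have k1 := hle 0 hI0 s hs hs.1
    have k2 := hle t ht 1 hI1 ht.2
    have k3 := toReal_transportDist_triangle hQ (hmem 0 hI0) (hmem s hs) (hmem 1 hI1)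
    have k4 := toReal_transportDist_triangle hQ (hmem s hs) (hmem t ht) (hmem 1 hI1)
    rw [hγ0] at k1
    rw [hγ1] at k2
    rw [hγ0, hγ1, ← hD] at k3
    rw [hγ1] at k4
    linarith
  have heq' : ∀ s ∈ Set.Icc (0 : ℝ) 1, ∀ t ∈ Set.Icc (0 : ℝ) 1, s ≤ t →
      transportDist Q (γ s) (γ t) = ENNReal.ofReal |t - s| * transportDist Q (γ 0) (γ 1) := by
    intro s hs t ht hst
    rw [hγ0, hγ1, hDW, ← ENNReal.ofReal_mul (abs_nonneg _), abs_of_nonneg (sub_nonneg.2 hst),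
      ← heq s hs t ht hst, ENNReal.ofReal_toReal (transportDist_ne_top hQ (hmem s hs) (hmem t ht))]
  refine ⟨γ, ⟨hmem, fun s hs t ht => ?_⟩, hγ0, hγ1⟩
  rcases le_total s t with hst | hst
  · exact heq' s hs t ht hst
  · rw [transportDist_comm hQ, abs_sub_comm]
    exact heq' t ht s hs hst

end

/-! ### The free energy: differentiability and first-order bounds -/

section

variable {X : Type*} [Fintype X] [DecidableEq X] {K : X → (X → ℝ) → ℝ}
  {Q : (X → ℝ) → Matrix X X ℝ}

theorem differentiableAt_energy (hQ : IsNonlinearMarkovTriple K Q) {μ : X → ℝ}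
    (hμ : μ ∈ stdSimplex ℝ X) : DifferentiableAt ℝ (energy K) μ := by
  unfold energy
  refine DifferentiableAt.fun_sum fun x _ => DifferentiableAt.mul (by fun_prop) ?_
  obtain ⟨V, hV, hSV, hK⟩ := hQ.contDiff_potential x
  exact (hK.contDiffAt (hV.mem_nhds (hSV hμ))).differentiableAt (by norm_num)

theorem continuousOn_freeEnergy (hQ : IsNonlinearMarkovTriple K Q) :
    ContinuousOn (freeEnergy K) (stdSimplex ℝ X) := by
  refine ContinuousOn.add (continuousOn_finsetSum _ fun x _ => ?_) fun μ hμ =>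
    (differentiableAt_energy hQ hμ).continuousAt.continuousWithinAt
  exact (Real.continuous_mul_log.comp (continuous_apply x)).continuousOn

/-- The entropy contributes `log μₓ + 1`, and the constant 1 disappears on vectors of zero sum, the
tangent vectors of the simplex. -/
theorem exists_hasFDerivAt_freeEnergy (hQ : IsNonlinearMarkovTriple K Q) {μ : X → ℝ}
    (hμ : μ ∈ stdSimplex ℝ X) (hpos : ∀ x, 0 < μ x) :
    ∃ L : (X → ℝ) →L[ℝ] ℝ, HasFDerivAt (freeEnergy K) L μ ∧
      ∀ v : X → ℝ, ∑ x, v x = 0 → L v = ∑ x, chemicalPotential K μ x * v x := by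
  have h1 : ∀ x ∈ Finset.univ, HasFDerivAt (fun ν : X → ℝ => ν x * Real.log (ν x))
      ((Real.log (μ x) + 1) • ContinuousLinearMap.proj (R := ℝ) (φ := fun _ : X => ℝ) x) μ :=
    fun x _ => HasDerivAt.comp_hasFDerivAt (h₂ := fun r : ℝ => r * Real.log r) μ
      (Real.hasDerivAt_mul_log (hpos x).ne')
      (ContinuousLinearMap.proj (R := ℝ) (φ := fun _ : X => ℝ) x).hasFDerivAt
  refine ⟨_, (HasFDerivAt.fun_sum h1).add (differentiableAt_energy hQ hμ).hasFDerivAt,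
    fun v hv => ?_⟩
  have h2 : fderiv ℝ (energy K) μ v = ∑ x, localHamiltonian K μ x * v x := by
    conv_lhs => rw [pi_eq_sum_univ' v]
    rw [map_sum]
    refine Finset.sum_congr rfl fun x _ => ?_
    rw [map_smul, smul_eq_mul, mul_comm]
    congr 2
  rw [add_apply, h2]
  simp only [FunLike.coe_sum, Finset.sum_apply, smul_apply,
    ContinuousLinearMap.proj_apply, smul_eq_mul, chemicalPotential, add_mul, one_mul,
    Finset.sum_add_distrib, hv, add_zero]

/-- Linear functionals decrease along `W` at most with the speed given by their action. -/
theorem exists_abs_sum_mul_sub_le (hQ : IsNonlinearMarkovTriple K Q) {μ : X → ℝ}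
    (hμ : μ ∈ stdSimplex ℝ X) (f : X → ℝ) {ε : ℝ} (hε : 0 < ε) :
    ∃ δ : ℝ, 0 < δ ∧ ∀ ρ ∈ stdSimplex ℝ X, (transportDist Q μ ρ).toReal < δ →
      |∑ x, f x * (ρ x - μ x)| ≤ √(action Q μ f + ε) * (transportDist Q μ ρ).toReal := by
  obtain ⟨C, hC0, hC⟩ := exists_abs_sub_le_transportDist hQ
  have hev : ∀ᶠ ρ in 𝓝[stdSimplex ℝ X] μ, action Q ρ f < action Q μ f + ε :=
    (hQ.continuousOn_action f μ hμ).eventually_lt_const (by linarith)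
  obtain ⟨r, hr, hball⟩ := Metric.mem_nhdsWithin_iff.1 hev
  have hA0 := hQ.action_nonneg hμ f
  refine ⟨r / (C + 1), by positivity, fun ρ hρ hlt => ?_⟩
  -- Any curve of energy at most `w²` starting at `μ` stays within Euclidean distance `C w < r` of
  -- it, where the action of `f` exceeds its value at `μ` by at most `ε`. Letting `w` decrease to
  -- `W` follows, as the infimum need not be attained.
  have key : ∀ w : ℝ, (transportDist Q μ ρ).toReal < w → w < r / (C + 1) →
      |∑ x, f x * (ρ x - μ x)| ≤ √(action Q μ f + ε) * w := by
    intro w hw hwr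
    have hw0 : 0 < w := ENNReal.toReal_nonneg.trans_lt hw
    obtain ⟨η, ψ, c, e, e', E⟩ := exists_of_transportDist_lt (Q := Q) (μ₀ := μ) (μ₁ := ρ)
      (r := w) ((ENNReal.lt_ofReal_iff_toReal_lt (transportDist_ne_top hQ hμ hρ)).2 hw)
    have hM : ∀ t ∈ Set.Icc (0 : ℝ) 1, action Q (η t) f ≤ action Q μ f + ε := by
      intro t ht
      have hmem := c.mem_simplex t ht
      have h1 := c.transportDist_zero_le hQ (sq_nonneg w) E ht.1 ht.2
      rw [e] at h1
      have h2 := ENNReal.toReal_mono ENNReal.ofReal_ne_top h1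
      rw [ENNReal.toReal_ofReal (Real.sqrt_nonneg _)] at h2
      have h3 : √(t * w ^ 2) ≤ w := Real.sqrt_le_iff.2
        ⟨hw0.le, mul_le_of_le_one_left (sq_nonneg w) ht.2⟩
      have h4 : dist (η t) μ ≤ C * w := by
        refine (dist_pi_le_iff (by positivity)).2 fun x => ?_
        rw [Real.dist_eq]
        exact (hC μ (η t) (transportDist_ne_top hQ hμ hmem) x).trans
          (mul_le_mul_of_nonneg_left (h2.trans h3) hC0)
      have h5 : C * w < r := by
        rw [lt_div_iff₀ (by positivity)] at hwr
        linarith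
      exact (hball ⟨h4.trans_lt h5, hmem⟩ : action Q (η t) f < _).le
    have h6 := c.abs_sum_mul_sub_le hQ hM (sq_nonneg w) E
    rwa [Real.sqrt_mul (by positivity), Real.sqrt_sq hw0.le, e, e'] at h6
  have hcont : Tendsto (fun w : ℝ => √(action Q μ f + ε) * w)
      (𝓝[>] (transportDist Q μ ρ).toReal)
      (𝓝 (√(action Q μ f + ε) * (transportDist Q μ ρ).toReal)) :=
    ((continuous_const.mul continuous_id).tendsto _).mono_left nhdsWithin_le_nhds
  refine ge_of_tendsto hcont ?_
  filter_upwards [Ioo_mem_nhdsGT hlt] with w hw using key w hw.1 hw.2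

/-! ### Consequences of convexity along geodesics -/

section Convexity

variable [Nonempty X] {lam : ℝ}

theorem exists_geodesic_freeEnergy_le (hQ : IsNonlinearMarkovTriple K Q)
    (hRic : RicciBoundedBelow K Q lam) {μ ν : X → ℝ}
    (hμ : μ ∈ stdSimplex ℝ X) (hν : ν ∈ stdSimplex ℝ X) :
    ∃ γ : ℝ → X → ℝ, ∀ t ∈ Set.Icc (0 : ℝ) 1, γ t ∈ stdSimplex ℝ X ∧
      (transportDist Q μ (γ t)).toReal = t * (transportDist Q μ ν).toReal ∧
      freeEnergy K (γ t) ≤ (1 - t) * freeEnergy K μ + t * freeEnergy K ν -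
        lam / 2 * t * (1 - t) * (transportDist Q μ ν).toReal ^ 2 := by
  obtain ⟨γ, hγ, h0, h1⟩ := exists_isGeodesic hQ hμ hν
  refine ⟨γ, fun t ht => ⟨hγ.1 t ht, ?_, ?_⟩⟩
  · have := hγ.2 0 ⟨le_rfl, zero_le_one⟩ t ht
    rw [h0, h1, sub_zero, abs_of_nonneg ht.1] at this
    rw [this, ENNReal.toReal_mul, ENNReal.toReal_ofReal ht.1]
  · have := hRic γ hγ t ht
    rwa [h0, h1] at this

/-- The HWI inequality. -/
theorem freeEnergy_sub_le_hwi (hQ : IsNonlinearMarkovTriple K Q) (hlam : 0 ≤ lam)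
    (hRic : RicciBoundedBelow K Q lam) {μ ν : X → ℝ}
    (hμ : μ ∈ stdSimplex ℝ X) (hpos : ∀ x, 0 < μ x) (hν : ν ∈ stdSimplex ℝ X) :
    freeEnergy K μ - freeEnergy K ν ≤
      √(action Q μ (chemicalPotential K μ)) * (transportDist Q μ ν).toReal -
        lam / 2 * (transportDist Q μ ν).toReal ^ 2 := by
  obtain ⟨γ, hγ⟩ := exists_geodesic_freeEnergy_le hQ hRic hμ hν
  obtain ⟨L, hL, hLf⟩ := exists_hasFDerivAt_freeEnergy hQ hμ hpos
  obtain ⟨C, hC0, hC⟩ := exists_abs_sub_le_transportDist hQ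
  set W := (transportDist Q μ ν).toReal with hW
  have hW0 : 0 ≤ W := ENNReal.toReal_nonneg
  set I := action Q μ (chemicalPotential K μ) with hI
  -- At a short time `t` of the geodesic, differentiability and the bound on linear functionals give
  -- `F(γ t) - F(μ) ≥ -t (√(I + ε) W + ε C W)`. Combining with convexity and dividing by `t` gives
  -- the estimate; `t ≤ ε` replaces `1 - t` by `1 - ε`.
  have key : ∀ ε : ℝ, 0 < ε → freeEnergy K μ - freeEnergy K ν ≤
      √(I + ε) * W + ε * (C * W) - lam / 2 * (1 - ε) * W ^ 2 := by
    intro ε hε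
    obtain ⟨δ, hδ, hlin⟩ := exists_abs_sum_mul_sub_le hQ hμ (chemicalPotential K μ) hε
    obtain ⟨r, hr, hdiff⟩ := Metric.eventually_nhds_iff.1 (hL.isLittleO.bound hε)
    obtain ⟨t, ht0, ht1, htε, htδ, htr⟩ : ∃ t : ℝ, 0 < t ∧ t ≤ 1 ∧ t ≤ ε ∧ t * W < δ ∧
        C * (t * W) < r := by
      have e1 : ∀ᶠ t : ℝ in 𝓝[>] 0, t < 1 := Ioo_mem_nhdsGT one_pos |> fun h => by
        filter_upwards [h] with t ht using ht.2
      have e2 : ∀ᶠ t : ℝ in 𝓝[>] 0, t < ε := by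
        filter_upwards [Ioo_mem_nhdsGT hε] with t ht using ht.2
      have e3 : ∀ᶠ t : ℝ in 𝓝[>] 0, t * W < δ :=
        ((by fun_prop : Continuous fun t : ℝ => t * W).tendsto' 0 0 (by simp)).mono_left
          nhdsWithin_le_nhds |>.eventually_lt_const hδ
      have e4 : ∀ᶠ t : ℝ in 𝓝[>] 0, C * (t * W) < r :=
        ((by fun_prop : Continuous fun t : ℝ => C * (t * W)).tendsto' 0 0 (by simp)).mono_left
          nhdsWithin_le_nhds |>.eventually_lt_const hr
      obtain ⟨t, ht, h1, h2, h3, h4⟩ :=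
        (eventually_mem_nhdsWithin.and (e1.and (e2.and (e3.and e4)))).exists
      exact ⟨t, ht, h1.le, h2.le, h3, h4⟩
    obtain ⟨hmem, hdist, hconv⟩ := hγ t ⟨ht0.le, ht1⟩
    have h1 := hlin _ hmem (by rwa [hdist])
    rw [hdist] at h1
    have h2 : dist (γ t) μ ≤ C * (t * W) := by
      refine (dist_pi_le_iff (by positivity)).2 fun x => ?_
      rw [Real.dist_eq, ← hdist]
      exact hC μ (γ t) (transportDist_ne_top hQ hμ hmem) x
    have h3 := hdiff (h2.trans_lt htr)
    rw [← dist_eq_norm (γ t) μ, Real.norm_eq_abs, hLf _ (by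
      simp only [Pi.sub_apply]
      rw [Finset.sum_sub_distrib, hmem.2, hμ.2, sub_self])] at h3
    have h4 : ε * dist (γ t) μ ≤ ε * (C * (t * W)) := by gcongr
    have h5 := (abs_le.1 (h3.trans h4)).1
    have h6 := (abs_le.1 h1).1
    simp only [Pi.sub_apply] at h5
    have h7 : t * (freeEnergy K μ - freeEnergy K ν) ≤
        t * (√(I + ε) * W + ε * (C * W) - lam / 2 * (1 - t) * W ^ 2) := by linarith
    refine (le_of_mul_le_mul_left h7 ht0).trans ?_
    have h8 : lam / 2 * (1 - ε) * W ^ 2 ≤ lam / 2 * (1 - t) * W ^ 2 := by gcongr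
    linarith
  have hcont : Tendsto (fun ε : ℝ => √(I + ε) * W + ε * (C * W) - lam / 2 * (1 - ε) * W ^ 2)
      (𝓝[>] 0) (𝓝 (√I * W - lam / 2 * W ^ 2)) :=
    ((by fun_prop : Continuous fun ε : ℝ =>
      √(I + ε) * W + ε * (C * W) - lam / 2 * (1 - ε) * W ^ 2).tendsto' 0 _ (by simp)).mono_left
      nhdsWithin_le_nhds
  refine ge_of_tendsto hcont ?_
  filter_upwards [self_mem_nhdsWithin] with ε hε using key ε hε

/-- The right side of HWI, as a quadratic in `W`, is largest at `W = √I / λ`, with value `I / (2λ)`.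
-/
theorem freeEnergy_sub_le_action (hQ : IsNonlinearMarkovTriple K Q) (hlam : 0 < lam)
    (hRic : RicciBoundedBelow K Q lam) {μ ν : X → ℝ}
    (hμ : μ ∈ stdSimplex ℝ X) (hpos : ∀ x, 0 < μ x) (hν : ν ∈ stdSimplex ℝ X) :
    freeEnergy K μ - freeEnergy K ν ≤
      1 / (2 * lam) * action Q μ (chemicalPotential K μ) := by
  refine (freeEnergy_sub_le_hwi hQ hlam.le hRic hμ hpos hν).trans ?_
  have hI := Real.sq_sqrt (hQ.action_nonneg hμ (chemicalPotential K μ))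
  set a := √(action Q μ (chemicalPotential K μ))
  rw [← hI, one_div_mul_eq_div, le_div_iff₀ (by positivity)]
  nlinarith [sq_nonneg (a - lam * (transportDist Q μ ν).toReal)]

/-- The transport inequality at a minimizer of the free energy. -/
theorem mul_sq_transportDist_le (hQ : IsNonlinearMarkovTriple K Q)
    (hRic : RicciBoundedBelow K Q lam) {θ μ : X → ℝ} (hθ : θ ∈ stdSimplex ℝ X)
    (hmin : ∀ ν ∈ stdSimplex ℝ X, freeEnergy K θ ≤ freeEnergy K ν) (hμ : μ ∈ stdSimplex ℝ X) :
    lam / 2 * (transportDist Q θ μ).toReal ^ 2 ≤ freeEnergy K μ - freeEnergy K θ := by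
  obtain ⟨γ, hγ⟩ := exists_geodesic_freeEnergy_le hQ hRic hθ hμ
  set W := (transportDist Q θ μ).toReal
  have hcont : Tendsto (fun t : ℝ => lam / 2 * (1 - t) * W ^ 2) (𝓝[>] 0)
      (𝓝 (lam / 2 * W ^ 2)) :=
    ((by fun_prop : Continuous fun t : ℝ => lam / 2 * (1 - t) * W ^ 2).tendsto' 0 _
      (by simp)).mono_left nhdsWithin_le_nhds
  refine le_of_tendsto hcont ?_
  -- As `F(γ t) ≥ F(θ)` on the geodesic leaving `θ`, convexity can be divided by `t`.
  filter_upwards [Ioo_mem_nhdsGT one_pos] with t ht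
  obtain ⟨hmem, -, hconv⟩ := hγ t ⟨ht.1.le, ht.2.le⟩
  have h1 := hmin _ hmem
  refine le_of_mul_le_mul_left ?_ ht.1
  linarith

/-- The transport inequality forces `W = 0`, and `W` dominates the differences of coordinates. -/
theorem eq_of_freeEnergy_le (hQ : IsNonlinearMarkovTriple K Q) (hlam : 0 < lam)
    (hRic : RicciBoundedBelow K Q lam) {θ μ : X → ℝ} (hθ : θ ∈ stdSimplex ℝ X)
    (hmin : ∀ ν ∈ stdSimplex ℝ X, freeEnergy K θ ≤ freeEnergy K ν) (hμ : μ ∈ stdSimplex ℝ X)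
    (hle : freeEnergy K μ ≤ freeEnergy K θ) : μ = θ := by
  have h1 := mul_sq_transportDist_le hQ hRic hθ hmin hμ
  obtain ⟨C, -, hC⟩ := exists_abs_sub_le_transportDist hQ
  have h2 : (transportDist Q θ μ).toReal ^ 2 ≤ 0 := by
    by_contra! h
    nlinarith [mul_pos hlam h]
  have h3 : (transportDist Q θ μ).toReal = 0 :=
    (pow_eq_zero_iff two_ne_zero).1 (h2.antisymm (sq_nonneg _))
  ext x
  have h4 := hC θ μ (transportDist_ne_top hQ hθ hμ) x
  rw [h3, mul_zero] at h4
  linarith [abs_nonpos_iff.1 h4]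

end Convexity

/-- Minimizers of the free energy have full support. -/
theorem pos_of_isMinOn_freeEnergy (hQ : IsNonlinearMarkovTriple K Q) {θ : X → ℝ}
    (hθ : θ ∈ stdSimplex ℝ X) (hmin : ∀ ν ∈ stdSimplex ℝ X, freeEnergy K θ ≤ freeEnergy K ν)
    (z : X) : 0 < θ z := by
  refine (hθ.1 z).lt_of_ne' fun hz => ?_
  have : Nonempty X := ⟨z⟩
  set N : ℝ := (Fintype.card X : ℝ) with hN
  have hN0 : 0 < N := by rw [hN]; exact_mod_cast Fintype.card_pos
  set u : ℝ := 1 / N with hu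
  have hu0 : 0 < u := by positivity
  have hNu : N * u = 1 := by rw [hu]; field_simp
  -- Moving towards the uniform measure, the coordinate vanishing at `z` contributes `s u log s`,
  -- while all other changes are at most linear in `s`.
  set v : X → ℝ := fun x => u - θ x with hv
  have hmem : ∀ s ∈ Set.Icc (0 : ℝ) 1, θ + s • v ∈ stdSimplex ℝ X := by
    refine fun s hs => ⟨fun x => ?_, ?_⟩
    · have h1 := mul_nonneg (sub_nonneg.2 hs.2) (hθ.1 x)
      have h2 := mul_nonneg hs.1 hu0.le
      simp only [Pi.add_apply, Pi.smul_apply, smul_eq_mul, hv]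
      linarith
    · simp only [Pi.add_apply, Pi.smul_apply, smul_eq_mul, hv]
      rw [Finset.sum_add_distrib, ← Finset.mul_sum, Finset.sum_sub_distrib, hθ.2, Finset.sum_const,
        nsmul_eq_mul, Finset.card_univ, ← hN, hNu]
      ring
  set S : ℝ := ∑ x, θ x * Real.log (θ x) with hS
  set T : ℝ := N * (u * Real.log u) with hT
  have hent : ∀ s ∈ Set.Ioo (0 : ℝ) 1,
      ∑ x, (θ + s • v) x * Real.log ((θ + s • v) x) ≤ (1 - s) * S + s * T + s * u * Real.log s := by
    intro s hs
    have hx : ∀ x ∈ Finset.univ, (θ + s • v) x * Real.log ((θ + s • v) x) ≤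
        (1 - s) * (θ x * Real.log (θ x)) + s * (u * Real.log u) +
          (if x = z then s * u * Real.log s else 0) := by
      intro x _
      have e : (θ + s • v) x = (1 - s) * θ x + s * u := by
        simp only [Pi.add_apply, Pi.smul_apply, smul_eq_mul, hv]
        ring
      rw [e]
      split_ifs with hxz
      · rw [hxz, hz, mul_zero, zero_add, Real.log_mul hs.1.ne' hu0.ne']
        simp only [zero_mul, mul_zero]
        linarith
      · have := Real.convexOn_mul_log.2 (Set.mem_Ici.2 (hθ.1 x)) (Set.mem_Ici.2 hu0.le)
          (sub_nonneg.2 hs.2.le) hs.1.le (sub_add_cancel 1 s)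
        simpa using this
    refine (Finset.sum_le_sum hx).trans (le_of_eq ?_)
    rw [Finset.sum_add_distrib, Finset.sum_add_distrib, ← Finset.mul_sum, ← Finset.mul_sum]
    simp [hN, hT, hS]
  obtain ⟨C, hC⟩ := (differentiableAt_energy hQ hθ).isBigO_sub.bound
  have hline : Tendsto (fun s : ℝ => θ + s • v) (𝓝[>] 0) (𝓝 θ) :=
    ((by fun_prop : Continuous fun s : ℝ => θ + s • v).tendsto' 0 _ (by simp)).mono_left
      nhdsWithin_le_nhds
  -- For such `s` the increment of `F`, at most `s (T - S + u log s + C ‖v‖)`, is negative.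
  have hlog : ∀ᶠ s : ℝ in 𝓝[>] 0, Real.log s < (S - T - C * ‖v‖) / u :=
    Real.tendsto_log_nhdsGT_zero.eventually_lt_atBot _
  obtain ⟨s, hs1, hs2, hs3⟩ :=
    ((hline.eventually hC).and (hlog.and (Ioo_mem_nhdsGT one_pos))).exists
  have h1 := hmin _ (hmem s ⟨hs3.1.le, hs3.2.le⟩)
  have h2 := hent s hs3
  rw [add_sub_cancel_left, norm_smul, Real.norm_eq_abs, Real.norm_eq_abs,
    abs_of_pos hs3.1] at hs1
  have h3 := (abs_le.1 hs1).2
  rw [lt_div_iff₀ hu0] at hs2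
  have h4 := mul_lt_mul_of_pos_left hs2 hs3.1
  unfold freeEnergy at h1
  linarith

/-- At an interior minimum the derivative in each direction `δₓ - δ_y` vanishes, so the chemical
potential is constant and the Onsager operator annihilates it. -/
theorem isStationary_of_isMinOn_freeEnergy (hQ : IsNonlinearMarkovTriple K Q) {θ : X → ℝ}
    (hθ : θ ∈ stdSimplex ℝ X) (hmin : ∀ ν ∈ stdSimplex ℝ X, freeEnergy K θ ≤ freeEnergy K ν) :
    IsStationary Q θ := by
  have hpos := pos_of_isMinOn_freeEnergy hQ hθ hmin
  obtain ⟨L, hL, hLf⟩ := exists_hasFDerivAt_freeEnergy hQ hθ hpos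
  have hconst : ∀ x y, chemicalPotential K θ x = chemicalPotential K θ y := by
    intro x y
    set v : X → ℝ := Pi.single x 1 - Pi.single y 1 with hv
    have hv0 : ∑ z, v z = 0 := by simp [hv]
    have hline : HasDerivAt (fun s : ℝ => θ + s • v) v 0 := by
      simpa using ((hasDerivAt_id (0 : ℝ)).smul_const v).const_add θ
    have hd : HasDerivAt (fun s : ℝ => freeEnergy K (θ + s • v)) (L v) 0 := by
      have hL0 : HasFDerivAt (freeEnergy K) L (θ + (0 : ℝ) • v) := by simpa using hL
      exact hL0.comp_hasDerivAt (0 : ℝ) hline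
    have hloc : IsLocalMin (fun s : ℝ => freeEnergy K (θ + s • v)) 0 := by
      have hev : ∀ᶠ s : ℝ in 𝓝 0, ∀ z, 0 < (θ + s • v) z := by
        refine eventually_all.2 fun z => ?_
        have hc : Continuous fun s : ℝ => (θ + s • v) z := by
          simp only [Pi.add_apply, Pi.smul_apply]
          fun_prop
        exact (hc.tendsto' 0 (θ z) (by simp)).eventually_const_lt (hpos z)
      filter_upwards [hev] with s hs
      rw [zero_smul, add_zero]
      refine hmin _ ⟨fun z => (hs z).le, ?_⟩
      simp only [Pi.add_apply, Pi.smul_apply, smul_eq_mul]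
      rw [Finset.sum_add_distrib, ← Finset.mul_sum, hv0, hθ.2, mul_zero, add_zero]
    have h0 := hloc.hasDerivAt_eq_zero hd
    rw [hLf v hv0] at h0
    simp only [hv, Pi.sub_apply, mul_sub, Finset.sum_sub_distrib, Pi.single_apply, mul_ite, mul_one,
      mul_zero, Finset.sum_ite_eq', Finset.mem_univ, if_true] at h0
    linarith
  refine ⟨hθ, ?_⟩
  ext x
  have h1 := hQ.onsager_chemicalPotential hθ hpos x
  have h2 : onsager Q θ (chemicalPotential K θ) x = 0 := by
    unfold onsager
    rw [Finset.sum_eq_zero fun y _ => by rw [hconst y x, sub_self, mul_zero], neg_zero]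
  rw [h2] at h1
  simpa using h1.symm

/-! ### Stationary points and dissipation along solutions -/

theorem IsStationary.pos (hQ : IsNonlinearMarkovTriple K Q) {ν : X → ℝ} (h : IsStationary Q ν)
    (x : X) : 0 < ν x :=
  hQ.pos_of_vecMul_eq_zero h.1 (fun x _ => congrFun h.2 x) x

theorem sum_chemicalPotential_mul_vecMul (hQ : IsNonlinearMarkovTriple K Q) {μ : X → ℝ}
    (hμ : μ ∈ stdSimplex ℝ X) (hpos : ∀ x, 0 < μ x) :
    ∑ x, chemicalPotential K μ x * (μ ᵥ* Q μ) x = -action Q μ (chemicalPotential K μ) := by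
  rw [action_eq_sum_mul_onsager, ← Finset.sum_neg_distrib]
  refine Finset.sum_congr rfl fun x _ => ?_
  rw [hQ.onsager_chemicalPotential hμ hpos]
  ring

/-- Solutions have full support at positive times. -/
theorem IsSolution.pos (hQ : IsNonlinearMarkovTriple K Q) {μ : ℝ → X → ℝ} (h : IsSolution Q μ)
    {t : ℝ} (ht : 0 < t) (x : X) : 0 < μ t x := by
  refine hQ.pos_of_vecMul_eq_zero (h t ht.le).1 (fun y hy => ?_) x
  have hd := hasDerivAt_pi.1 ((h t ht.le).2.hasDerivAt (Ici_mem_nhds ht)) y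
  -- A coordinate that vanishes at a positive time is at a minimum in time, so the drift there is
  -- zero.
  refine IsLocalMin.hasDerivAt_eq_zero ?_ hd
  filter_upwards [Ici_mem_nhds ht] with s hs
  rw [hy]
  exact (h s hs).1.1 y

theorem IsSolution.hasDerivAt_freeEnergy (hQ : IsNonlinearMarkovTriple K Q) {μ : ℝ → X → ℝ}
    (h : IsSolution Q μ) {t : ℝ} (ht : 0 < t) :
    HasDerivAt (fun t => freeEnergy K (μ t)) (-action Q (μ t) (chemicalPotential K (μ t))) t := by
  obtain ⟨hmem, hd⟩ := h t ht.le
  have hpos := IsSolution.pos hQ h ht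
  obtain ⟨L, hL, hLf⟩ := exists_hasFDerivAt_freeEnergy hQ hmem hpos
  have h1 := hL.comp_hasDerivAt t (hd.hasDerivAt (Ici_mem_nhds ht))
  have h2 : ∑ x, (μ t ᵥ* Q (μ t)) x = 0 := by
    have := sum_onsager Q (μ t) (chemicalPotential K (μ t))
    simp only [hQ.onsager_chemicalPotential hmem hpos, Finset.sum_neg_distrib] at this
    linarith
  rwa [hLf _ h2, sum_chemicalPotential_mul_vecMul hQ hmem hpos] at h1

/-- Gronwall: dissipation and (ii) make `e^(2λt) (F(μ_t) - F(ν))` nonincreasing. The initial measure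
may lack full support, so the derivative is used for positive times only, with continuity at 0. -/
theorem IsSolution.freeEnergy_sub_le [Nonempty X] {lam : ℝ} (hQ : IsNonlinearMarkovTriple K Q)
    (hlam : 0 < lam) (hRic : RicciBoundedBelow K Q lam) {μ : ℝ → X → ℝ} (h : IsSolution Q μ)
    {ν : X → ℝ} (hν : ν ∈ stdSimplex ℝ X) {t : ℝ} (ht : 0 ≤ t) :
    freeEnergy K (μ t) - freeEnergy K ν ≤
      Real.exp (-2 * lam * t) * (freeEnergy K (μ 0) - freeEnergy K ν) := by
  set g : ℝ → ℝ := fun t => Real.exp (2 * lam * t) * (freeEnergy K (μ t) - freeEnergy K ν) with hg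
  have hcont : ContinuousOn g (Set.Ici 0) := by
    refine ContinuousOn.mul (by fun_prop) (ContinuousOn.sub ?_ continuousOn_const)
    exact (continuousOn_freeEnergy hQ).comp (fun s hs => (h s hs).2.continuousWithinAt)
      fun s hs => (h s hs).1
  have hderiv : ∀ s ∈ interior (Set.Ici (0 : ℝ)), HasDerivWithinAt g
      (Real.exp (2 * lam * s) * (2 * lam * (freeEnergy K (μ s) - freeEnergy K ν) -
        action Q (μ s) (chemicalPotential K (μ s)))) (interior (Set.Ici 0)) s := by
    intro s hs
    rw [interior_Ici] at hs
    have h1 : HasDerivAt (fun s : ℝ => Real.exp (2 * lam * s))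
        (Real.exp (2 * lam * s) * (2 * lam)) s := by
      simpa using ((hasDerivAt_id s).const_mul (2 * lam)).exp
    have h2 := h1.mul ((h.hasDerivAt_freeEnergy hQ hs).sub_const (freeEnergy K ν))
    exact (h2.congr_deriv (by ring)).hasDerivWithinAt
  have hanti : AntitoneOn g (Set.Ici 0) :=
    antitoneOn_of_hasDerivWithinAt_nonpos (convex_Ici 0) hcont hderiv fun s hs => by
      rw [interior_Ici] at hs
      have h1 := freeEnergy_sub_le_action hQ hlam hRic (h s hs.le).1 (h.pos hQ hs) hν
      rw [one_div_mul_eq_div, le_div_iff₀ (by positivity)] at h1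
      exact mul_nonpos_of_nonneg_of_nonpos (Real.exp_pos _).le (by linarith)
  have h0 := hanti (Set.mem_Ici.2 le_rfl) (Set.mem_Ici.2 ht) ht
  simp only [hg, mul_zero, Real.exp_zero, one_mul] at h0
  have h1 := mul_le_mul_of_nonneg_left h0 (Real.exp_pos (-2 * lam * t)).le
  rwa [← mul_assoc, ← Real.exp_add, show -2 * lam * t + 2 * lam * t = 0 by ring, Real.exp_zero,
    one_mul] at h1

end

end

end MeanField

open MeanField in
theorem theorem1p1 {X : Type*} [Fintype X] [DecidableEq X] [Nonempty X]
    (K : X → (X → ℝ) → ℝ) (Q : (X → ℝ) → Matrix X X ℝ)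
    (hQ : MeanField.IsNonlinearMarkovTriple K Q)
    (lam : ℝ) (hlam : 0 < lam) (hRic : MeanField.RicciBoundedBelow K Q lam) :
    ∃ πs : X → ℝ,
      -- (i) the unique stationary point, which is the unique minimizer of the free energy
      (MeanField.IsStationary Q πs ∧ ∀ ν, MeanField.IsStationary Q ν → ν = πs) ∧
      (∀ ν ∈ stdSimplex ℝ X, ν ≠ πs → MeanField.freeEnergy K πs < MeanField.freeEnergy K ν) ∧
      -- (ii) the modified logarithmic Sobolev inequality
      (∀ μ ∈ stdSimplex ℝ X,
        ENNReal.ofReal (MeanField.freeEnergy K μ - MeanField.freeEnergy K πs) ≤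
          ENNReal.ofReal (1 / (2 * lam)) * MeanField.fisher Q μ) ∧
      -- (iii) exponential decay of the free energy
      (∀ μ : ℝ → X → ℝ, MeanField.IsSolution Q μ → ∀ t, 0 ≤ t →
        MeanField.freeEnergy K (μ t) - MeanField.freeEnergy K πs ≤
          Real.exp (-2 * lam * t) *
            (MeanField.freeEnergy K (μ 0) - MeanField.freeEnergy K πs)) ∧
      -- (iv) the transport-entropy inequality
      (∀ μ ∈ stdSimplex ℝ X,
        MeanField.transportDist Q μ πs ≤
          ENNReal.ofReal
            (Real.sqrt (2 / lam * (MeanField.freeEnergy K μ - MeanField.freeEnergy K πs)))) := by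
  obtain ⟨θ, hθ, hmin'⟩ := (isCompact_stdSimplex ℝ X).exists_isMinOn
    ⟨_, single_mem_stdSimplex ℝ (Classical.arbitrary X)⟩ (continuousOn_freeEnergy hQ)
  have hmin : ∀ ν ∈ stdSimplex ℝ X, freeEnergy K θ ≤ freeEnergy K ν := fun ν hν => hmin' hν
  refine ⟨θ, ⟨isStationary_of_isMinOn_freeEnergy hQ hθ hmin, fun ν hν => ?_⟩, fun ν hν hne => ?_,
    fun μ hμ => ?_, fun μ hμ t ht => hμ.freeEnergy_sub_le hQ hlam hRic hθ ht, fun μ hμ => ?_⟩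
  · refine eq_of_freeEnergy_le hQ hlam hRic hθ hmin hν.1 ?_
    -- The drift vanishes at a stationary point, hence so does the Fisher information, and the
    -- logarithmic Sobolev inequality gives `F(ν) ≤ F(θ)`.
    have h1 := sum_chemicalPotential_mul_vecMul hQ hν.1 (hν.pos hQ)
    have h2 := freeEnergy_sub_le_action hQ hlam hRic hν.1 (hν.pos hQ) hθ
    simp only [hν.2, Pi.zero_apply, mul_zero, Finset.sum_const_zero] at h1
    rw [neg_eq_zero.1 h1.symm, mul_zero] at h2
    linarith
  · by_contra! hle
    exact hne (eq_of_freeEnergy_le hQ hlam hRic hθ hmin hν hle)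
  · unfold fisher
    split_ifs with hpos
    · rw [← ENNReal.ofReal_mul (by positivity), ← hQ.action_chemicalPotential hμ hpos]
      exact ENNReal.ofReal_le_ofReal (freeEnergy_sub_le_action hQ hlam hRic hμ hpos hθ)
    · rw [ENNReal.mul_top (by simpa using hlam)]
      exact le_top
  · have h1 := mul_sq_transportDist_le hQ hRic hθ hmin hμ
    rw [transportDist_comm hQ, ← ENNReal.ofReal_toReal (transportDist_ne_top hQ hθ hμ)]
    refine ENNReal.ofReal_le_ofReal (Real.le_sqrt_of_sq_le ?_)
    rw [div_mul_eq_mul_div, le_div_iff₀ hlam]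
    linarith
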